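/- Let $x=(x_1,x_2,x_3,\dots)$, $\partial_i=\partial/\partial x_i$ and $\partial=\partial_1$. For a formal power series $v\in\mathbb C[[x_1,x_2,\dots]]$ (thought of as $v=-\ln\tau$) define $$\eta_r=\sum_{n\ge 1}\ \sum_{\substack{i_1+\dots+i_n=r\\ i_a\ge 1}}\frac{(-1)^{n+1}}{n!\,i_1\cdots i_n}\,\partial_{i_1}\cdots\partial_{i_n}v\quad(r\ge1),\qquad \psi=\exp\Big(\sum_{j\ge1}x_jk^j\Big)\exp\Big(\sum_{r\ge1}\eta_rk^{-r}\Big),$$ so that formally $\psi=\exp(\sum_j x_jk^j)\,\tau(x_1-k^{-1},x_2-\tfrac12k^{-2},\dots)/\tau(x)$. Call $v$ a formal solution of the KP hierarchy if for every $n\ge1$ there are formal power series $B_n^2,\dots,B_n^n$ in $x$ with $$\partial_n\psi=\Big(\partial^n+\sum_{i=2}^nB_n^i\,\partial^{\,n-i}\Big)\psi .$$ There is exactly one family of rational coefficients $$R_{ij}\begin{pmatrix}s_1&\cdots&s_m\\ t_1&\cdots&t_m\end{pmatrix}\in\mathbb Q,\qquad i,j,s_a,t_a\ge1,\quad \sum_{a=1}^m(s_a+t_a)=i+j,$$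 indexed by $i,j$ and finite unordered collections (with repetitions) of columns $(s_a,t_a)$, such that every formal solution $v$ of the KP hierarchy satisfies, for all $i,j\ge1$, $$\partial_i\partial_jv=\sum R_{ij}\begin{pmatrix}s_1&\cdots&s_m\\ t_1&\cdots&t_m\end{pmatrix}\,\partial_{s_1}\partial^{t_1}v\cdots\partial_{s_m}\partial^{t_m}v,$$ the sum being over all unordered collections of columns with $s_a,t_a\ge1$ and $\sum_a(s_a+t_a)=i+j$. These coefficients satisfy $$R_{ij}\begin{pmatrix}s_1&\cdots&s_m\\ t_1&\cdots&t_m\end{pmatrix}=0\quad\text{whenever}\quad\sum_{a=1}^m(t_a+1)\equiv1\pmod 2 .$$ -/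

import Mathlib

noncomputable section

namespace KP

/-- Formal power series with complex coefficients in the infinitely many KP times
`x₁, x₂, x₃, …`. -/
abbrev TimeSeries : Type := MvPowerSeries ℕ+ ℂ

/-- `∂_i = ∂/∂x_i`. -/
def D (i : ℕ+) : Derivation ℂ TimeSeries TimeSeries := MvPowerSeries.pderiv ℂ i

/-- `∂_{i₁} ⋯ ∂_{iₙ} v` for a list `i₁, …, iₙ` of indices. -/
def iterD (l : List ℕ+) (v : TimeSeries) : TimeSeries := l.foldr (fun i f => D i f) v

/-- The list of parts of a composition `i₁ + ⋯ + iₙ = r`, as positive integers. -/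
def parts {r : ℕ} (c : Composition r) : List ℕ+ :=
  List.ofFn fun a => (⟨c.blocksFun a, c.one_le_blocksFun a⟩ : ℕ+)

/-- The coefficient of `k^{-r}` in `v(x) - v(x₁ - k⁻¹, x₂ - k⁻²/2, x₃ - k⁻³/3, …)`, that is,
`η_r = ∑_{n ≥ 1} ∑_{i₁ + ⋯ + iₙ = r} (-1)^{n+1} / (n! i₁ ⋯ iₙ) ∂_{i₁} ⋯ ∂_{iₙ} v`
(for `r ≥ 1`), expressing `log (τ(x - [k⁻¹]) / τ(x)) = ∑_{r ≥ 1} η_r k^{-r}` through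
`v = - log τ`. -/
def eta (v : TimeSeries) (r : ℕ) : TimeSeries :=
  ∑ c : Composition r,
    ((-1 : ℚ) ^ (c.length + 1) / ((c.length.factorial : ℚ) * (c.blocks.prod : ℚ))) •
      iterD (parts c) v

/-- The coefficient of `k^{-j}` in `exp (∑_{r ≥ 1} η_r k^{-r})`, that is,
`ξ_j = ∑_n (1/n!) ∑_{i₁ + ⋯ + iₙ = j} η_{i₁} ⋯ η_{iₙ}`; in particular `ξ_0 = 1`
(the empty composition of `0`). -/
def xi (v : TimeSeries) (j : ℕ) : TimeSeries :=
  ∑ c : Composition j, (1 / (c.length.factorial : ℚ)) • (c.blocks.map (eta v)).prod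

/-- Laurent series in `k⁻¹` over the power series in the times: the coefficient of index
`m : ℤ` is the coefficient of `k^{-m}`. -/
abbrev WaveSeries : Type := LaurentSeries TimeSeries

/-- The spectral parameter `k`. -/
def k : WaveSeries := HahnSeries.single (-1 : ℤ) 1

/-- `w = 1 + ∑_{j ≥ 1} ξ_j k^{-j} = τ(x - [k⁻¹]) / τ(x)`, so that the Baker-Akhiezer function is
`ψ = exp (∑ x_j k^j) w`. -/
def wave (v : TimeSeries) : WaveSeries :=
  HahnSeries.ofPowerSeries ℤ TimeSeries (PowerSeries.mk (xi v))

/-- The action of `∂/∂x_i` on formal functions `exp (∑ x_j k^j) f`, written on the factor `f`: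
`∂_i (exp (∑ x_j k^j) f) = exp (∑ x_j k^j) (∂_i f + k^i f)`, where `∂_i f` is taken
coefficientwise. -/
def waveD (i : ℕ+) (f : WaveSeries) : WaveSeries := f.map (D i) + k ^ (i : ℕ) * f

/-- `v = - log τ` is a formal solution of the KP hierarchy: for every `n ≥ 1` there is a
differential operator `L_n = ∂₁ⁿ + ∑_{i=2}^n B_n^i(x) ∂₁^{n-i}` with `∂ψ/∂x_n = L_n ψ`, where
`ψ` is the Baker-Akhiezer function attached to `v`. -/
def IsSolution (v : TimeSeries) : Prop :=
  ∀ n : ℕ+, ∃ B : ℕ → TimeSeries,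
    waveD n (wave v) =
      (waveD 1)^[n] (wave v) +
        ∑ i ∈ Finset.Icc 2 (n : ℕ), HahnSeries.C (B i) * (waveD 1)^[n - i] (wave v)

/-- A column `(s, t)` with `s, t ≥ 1`. -/
abbrev Column : Type := ℕ+ × ℕ+

/-- The function `∂_s ∂₁^t v` attached to a column `(s, t)`. -/
def jet (v : TimeSeries) (c : Column) : TimeSeries := D c.1 ((D 1)^[c.2] v)

/-- The monomial with columns `(s₁, t₁), …, (s_m, t_m)`; it stands for the product
`∂_{s₁} ∂₁^{t₁} v ⋯ ∂_{s_m} ∂₁^{t_m} v`. -/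
def columns {m : ℕ} (s t : Fin m → ℕ+) : Column →₀ ℕ :=
  ∑ a, Finsupp.single (s a, t a) 1

/-- `R` is a system of universal rational coefficients of the KP hierarchy. The coefficient
attached to the columns `(s₁, t₁), …, (s_m, t_m)` is the coefficient of the polynomial `R i j` at
the corresponding monomial. The first condition says that only columns with
`s₁ + ⋯ + s_m + t₁ + ⋯ + t_m = i + j` occur; the second one is the system
`∂_i ∂_j v = ∑ R_{ij} (s₁ ⋯ s_m; t₁ ⋯ t_m) ∂_{s₁} ∂₁^{t₁} v ⋯ ∂_{s_m} ∂₁^{t_m} v`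
for all formal solutions `v`. -/
def IsUniversal (R : ℕ+ → ℕ+ → MvPolynomial Column ℚ) : Prop :=
  ∀ i j : ℕ+,
    (R i j).IsWeightedHomogeneous (fun c : Column => (c.1 + c.2 : ℕ)) (i + j : ℕ) ∧
    ∀ v : TimeSeries, IsSolution v → D i (D j v) = MvPolynomial.aeval (jet v) (R i j)

end KP

end

/-! Let T_y be the Miwa shift x_j ↦ x_j - y^j/j, let S_r be its coefficient at y^r (`shiftOp`), and
let w(z) = T_z τ / τ, so that log w(z) = ∑ η_r z^r with η_r = -S_r v for r ≥ 1.

Existence. The shift multiplies exp(∑ x_j k^j) by 1 - yk. For a solution, every coefficient of T_y ψ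
lies in the span of the ∂^i ψ. The coefficients at y^m with m ≥ 2 contain no positive power of k
beside the exponential, so they are multiples of ψ. This rewrites the hierarchy as the equivalent
system `ShiftEquations`, whose generating form is T_y w(z) / w(z) = 1 - ∑_{a,b≥1} ∂η_{a+b-1} y^a
z^b. Logarithmic differentiation in z expresses S_a S_b v through ∂η_{a+b-1} and products of
functions of smaller weight (`natCast_mul_shiftOp_shiftOp`). Since S_r is -∂_r/r plus operators of
order at least 2, induction on the weight makes every ∂_i ∂_j v a universal polynomial in the jets
(`isJetPoly_iterD`).

Uniqueness. Soliton determinants change under T_y by a matrix of rank one, and this makes them tau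
functions (`isSolution_of_rank_one`). Scaling a soliton by ε gives τ = 1 + ε tr + ..., so the
first-order jets at the origin are combinations of the vectors with entries (p^s - q^s)(p - q)^t.
These entries are linearly independent functions of p and q, so the lowest homogeneous part of a
polynomial vanishing on all soliton jets is zero (`eq_zero_of_eval_jet`).

Parity. The reflection x ↦ -x exchanges p and q and transposes the determinant, so it preserves
solitons. It multiplies the jet of a column (s, t) by (-1)^(t+1) and leaves the sign of ∂_i ∂_j v
unchanged; by density the coefficients must agree with this sign. -/

noncomputable section

namespace KP

open Finset hiding antidiagonal mem_antidiagonal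
open Finset.HasAntidiagonal (antidiagonal mem_antidiagonal)

/-! ### Exponentials of power series as sums over compositions -/

section CompositionSums

variable {A : Type*} [CommRing A]

/-- The power series `∑_{j ≥ 1} a_j Xʲ`. -/
def posSeries (a : ℕ → A) : PowerSeries A := PowerSeries.mk fun j => if j = 0 then 0 else a j

lemma sum_composition_zero {M : Type*} [AddCommMonoid M] (f : Composition 0 → M) :
    ∑ c, f c = f (Composition.ones 0) := by
  refine Fintype.sum_eq_single _ fun c hc => (hc (Composition.ext ?_)).elim
  rw [c.blocks_eq_nil.mpr rfl]
  rfl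

lemma coeff_posSeries_pow (a : ℕ → A) (n r : ℕ) :
    PowerSeries.coeff r (posSeries a ^ n) =
      ∑ c : Composition r with c.length = n, (c.blocks.map a).prod := by
  induction n generalizing r with
  | zero =>
    rcases Nat.eq_zero_or_pos r with rfl | hr
    · have : (univ.filter fun c : Composition 0 => c.length = 0) = univ := by
        ext c; simp
      rw [this]
      rw [pow_zero, PowerSeries.coeff_one, if_pos rfl, sum_composition_zero]
      simp [Composition.ones]
    · rw [pow_zero, PowerSeries.coeff_one, if_neg hr.ne', Finset.sum_eq_zero]
      intro c hc
      have := (c.length_pos_iff).mpr hr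
      simp only [mem_filter] at hc
      omega
  | succ n ih =>
    rw [pow_succ', PowerSeries.coeff_mul]
    have h1 : ∀ p ∈ antidiagonal r, PowerSeries.coeff p.1 (posSeries a) *
        PowerSeries.coeff p.2 (posSeries a ^ n) =
        ∑ c : Composition p.2 with (c.length = n ∧ p.1 ≠ 0), a p.1 * (c.blocks.map a).prod := by
      intro p _
      rw [ih, posSeries, PowerSeries.coeff_mk]
      by_cases h : p.1 = 0
      · simp [h]
      · simp [h, Finset.mul_sum]
    rw [Finset.sum_congr rfl h1, Finset.sum_sigma']
    -- Splitting off the first block matches one factor of the series with a composition of the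
    -- remainder.
    refine Finset.sum_bij (fun x hx => ⟨x.1.1 :: x.2.blocks, ?_, ?_⟩) ?_ ?_ ?_ ?_
    · intro i hi
      simp only [mem_sigma, mem_filter] at hx
      rcases List.mem_cons.mp hi with rfl | hi
      · exact Nat.pos_of_ne_zero hx.2.2.2
      · exact x.2.blocks_pos hi
    · simp only [mem_sigma, mem_antidiagonal] at hx
      simpa using hx.1
    · intro x hx
      simp only [mem_sigma, mem_filter] at hx
      simp only [mem_filter, mem_univ, true_and]
      simp only [Composition.length, List.length_cons]
      rw [Composition.blocks_length, hx.2.2.1]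
    · rintro ⟨⟨j, l⟩, c⟩ hx ⟨⟨j', l'⟩, c'⟩ hx' h
      have h2 := congrArg Composition.blocks h
      simp only [List.cons.injEq] at h2
      obtain ⟨rfl, h2⟩ := h2
      have : l = l' := (c.blocks_sum).symm.trans ((congrArg List.sum h2).trans c'.blocks_sum)
      subst this
      have : c = c' := Composition.ext h2
      subst this
      rfl
    · intro c hc
      simp only [mem_filter, mem_univ, true_and] at hc
      obtain ⟨b, hpos, hsum⟩ := c
      cases b with
      | nil => simp [Composition.length] at hc
      | cons j t =>
        refine ⟨⟨(j, t.sum), ⟨t, fun hi => hpos (List.mem_cons_of_mem _ hi), rfl⟩⟩, ?_, ?_⟩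
        · have hj : 0 < j := hpos (List.mem_cons_self)
          simp only [Composition.length, List.length_cons] at hc
          simp only [mem_sigma, mem_antidiagonal, mem_filter, mem_univ, true_and]
          refine ⟨by simpa using hsum, ?_, hj.ne'⟩
          simp only [Composition.length]
          omega
        · rfl
    · intro x hx
      simp

variable [Algebra ℚ A]

/-- The coefficient of `Xʳ` in `exp (∑_{j ≥ 1} a_j Xʲ)`, as a sum over compositions. -/
def expCoeff (a : ℕ → A) (r : ℕ) : A :=
  ∑ c : Composition r, (1 / (c.length.factorial : ℚ)) • (c.blocks.map a).prod

lemma expCoeff_zero (a : ℕ → A) : expCoeff a 0 = 1 := by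
  rw [expCoeff, sum_composition_zero]
  rw [Composition.ones_blocks, Composition.ones_length]
  simp

lemma expCoeff_eq_sum (a : ℕ → A) {r N : ℕ} (h : r < N) :
    expCoeff a r =
      ∑ n ∈ range N, (1 / (n.factorial : ℚ)) • PowerSeries.coeff r (posSeries a ^ n) := by
  have : ∀ n ∈ range N, (1 / (n.factorial : ℚ)) • PowerSeries.coeff r (posSeries a ^ n) =
      ∑ c : Composition r with c.length = n,
        (1 / (c.length.factorial : ℚ)) • (c.blocks.map a).prod := by
    intro n _
    rw [coeff_posSeries_pow, Finset.smul_sum]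
    refine Finset.sum_congr rfl fun c hc => ?_
    simp only [mem_filter] at hc
    rw [hc.2]
  rw [Finset.sum_congr rfl this, expCoeff]
  refine (Finset.sum_fiberwise_of_maps_to (fun c _ => ?_) _).symm
  have := c.length_le
  simp only [mem_range]; omega

/-- This is X E' = X A' E for E = exp A, read off coefficientwise. Later arguments about
exponentials use this recursion instead of compositions. -/
lemma smul_expCoeff (a : ℕ → A) (r : ℕ) :
    (r : A) * expCoeff a r =
      ∑ p ∈ antidiagonal r, (p.1 : A) * a p.1 * expCoeff a p.2 := by
  cases r with
  | zero => simp
  | succ r =>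
    have h1 : ∀ n : ℕ, ((r + 1 : ℕ) : A) * PowerSeries.coeff (r + 1) (posSeries a ^ (n + 1)) =
        (n + 1) • ∑ p ∈ antidiagonal (r + 1), (p.1 : A) * a p.1 *
          PowerSeries.coeff p.2 (posSeries a ^ n) := by
      intro n
      have h := congrArg (PowerSeries.coeff r)
        (Derivation.leibniz_pow (PowerSeries.derivative A) (posSeries a) (n + 1))
      rw [PowerSeries.coeff_derivative] at h
      rw [mul_comm, Nat.cast_succ, h, Nat.add_sub_cancel, map_nsmul, smul_eq_mul, mul_comm,
        PowerSeries.coeff_mul, Finset.Nat.antidiagonal_succ, Finset.sum_cons, Finset.sum_map]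
      congr 1
      simp only [Nat.cast_zero, zero_mul, zero_add]
      refine Finset.sum_congr rfl fun p _ => ?_
      rw [PowerSeries.coeff_derivative, posSeries, PowerSeries.coeff_mk]
      simp [mul_comm]
    have h2 : ∀ n ∈ range (r + 1),
        ((r + 1 : ℕ) : A) * ((1 / ((n + 1).factorial : ℚ)) •
          PowerSeries.coeff (r + 1) (posSeries a ^ (n + 1))) =
        ∑ p ∈ antidiagonal (r + 1), (p.1 : A) * a p.1 *
          ((1 / (n.factorial : ℚ)) • PowerSeries.coeff p.2 (posSeries a ^ n)) := by
      intro n _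
      rw [mul_smul_comm, h1, ← Nat.cast_smul_eq_nsmul ℚ, smul_smul, Finset.smul_sum]
      refine Finset.sum_congr rfl fun p _ => ?_
      rw [mul_smul_comm]
      congr 1
      rw [Nat.factorial_succ]
      have := Nat.factorial_ne_zero n
      have : (n.factorial : ℚ) ≠ 0 := by exact_mod_cast this
      push_cast
      field_simp
    rw [expCoeff_eq_sum a (show r + 1 < r + 2 by omega), Finset.sum_range_succ',
      pow_zero, PowerSeries.coeff_one, if_neg (Nat.succ_ne_zero r), smul_zero, add_zero,
      Finset.mul_sum, Finset.sum_congr rfl h2, Finset.sum_comm]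
    refine Finset.sum_congr rfl fun p hp => ?_
    rw [← Finset.mul_sum]
    by_cases hp0 : p.1 = 0
    · simp [hp0]
    · rw [← expCoeff_eq_sum]
      have := mem_antidiagonal.mp hp
      omega

end CompositionSums

/-! ### Reindexing double antidiagonal sums -/

section Triples

variable {M : Type*} [AddCommMonoid M]

lemma sum_antidiagonal_assoc (r : ℕ) (f : ℕ → ℕ → ℕ → M) :
    ∑ p ∈ antidiagonal r, ∑ q ∈ antidiagonal p.2, f p.1 q.1 q.2 =
      ∑ p ∈ antidiagonal r, ∑ q ∈ antidiagonal p.1, f q.1 q.2 p.2 := by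
  rw [Finset.sum_sigma', Finset.sum_sigma']
  refine Finset.sum_nbij' (fun x => ⟨(x.1.1 + x.2.1, x.2.2), (x.1.1, x.2.1)⟩)
    (fun x => ⟨(x.2.1, x.2.2 + x.1.2), (x.2.2, x.1.2)⟩) ?_ ?_ ?_ ?_ ?_ <;>
  rintro ⟨⟨a, b⟩, ⟨c, d⟩⟩ h <;> simp only [mem_sigma, mem_antidiagonal, and_true] at h ⊢
  · omega
  · omega
  · obtain ⟨rfl, rfl⟩ := h; rfl
  · obtain ⟨rfl, rfl⟩ := h; rfl

lemma sum_antidiagonal_left_comm (r : ℕ) (f : ℕ → ℕ → ℕ → M) :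
    ∑ p ∈ antidiagonal r, ∑ q ∈ antidiagonal p.2, f p.1 q.1 q.2 =
      ∑ p ∈ antidiagonal r, ∑ q ∈ antidiagonal p.2, f q.1 p.1 q.2 := by
  rw [Finset.sum_sigma', Finset.sum_sigma']
  refine Finset.sum_nbij' (fun x => ⟨(x.2.1, x.1.1 + x.2.2), (x.1.1, x.2.2)⟩)
    (fun x => ⟨(x.2.1, x.1.1 + x.2.2), (x.1.1, x.2.2)⟩) ?_ ?_ ?_ ?_ ?_ <;>
  rintro ⟨⟨a, b⟩, ⟨c, d⟩⟩ h <;> simp only [mem_sigma, mem_antidiagonal, and_true] at h ⊢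
  · omega
  · omega
  · obtain ⟨rfl, rfl⟩ := h; rfl
  · obtain ⟨rfl, rfl⟩ := h; rfl

end Triples

/-! ### The Miwa shift and its coefficients -/

section ShiftOperators

lemma D_comm (i j : ℕ+) (f : TimeSeries) : D i (D j f) = D j (D i f) := by
  by_cases h : i = j
  · rw [h]
  ext m
  simp only [D, MvPowerSeries.coeff_pderiv, Finsupp.add_apply]
  rw [Finsupp.single_eq_of_ne h, Finsupp.single_eq_of_ne (Ne.symm h), add_right_comm]
  push_cast
  ring

/-- `∂_i` as a `ℚ`-linear operator. -/
def dEnd (i : ℕ+) : Module.End ℚ TimeSeries := (D i).toLinearMap.restrictScalars ℚ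

/-- The commutative algebra generated by the operators `∂_i`. -/
abbrev ConstOps : Subalgebra ℚ (Module.End ℚ TimeSeries) := Algebra.adjoin ℚ (Set.range dEnd)

/-- Exponentials were set up over commutative rings; commutativity allows `expCoeff` to be applied
to operators. -/
lemma constOps_mul_comm (P Q : ConstOps) : P * Q = Q * P := by
  have := Algebra.isMulCommutative_adjoin ℚ (s := Set.range dEnd) (by
    rintro _ ⟨i, rfl⟩ _ ⟨j, rfl⟩
    ext1 f
    exact D_comm i j f)
  exact mul_comm' P Q

instance : CommRing ConstOps := { (inferInstance : Ring ConstOps) with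
  mul_comm := constOps_mul_comm }

/-- `-∂_j / j`, with the value `0` at `j = 0`. -/
def logShift (j : ℕ) : ConstOps :=
  if j = 0 then 0 else (-(1 / (j : ℚ))) • ⟨dEnd j.toPNat', Algebra.subset_adjoin ⟨_, rfl⟩⟩

lemma coe_prod_logShift (l : List ℕ+) (v : TimeSeries) :
    ((l.map fun i : ℕ+ => logShift i).prod : ConstOps).1 v =
      ((-1 : ℚ) ^ l.length / ((l.map fun i : ℕ+ => (i : ℕ)).prod : ℚ)) • iterD l v := by
  induction l with
  | nil => simp [iterD]
  | cons i l ih =>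
    have h : (logShift i : ConstOps).1 = (-(1 / (i : ℚ))) • dEnd i := by
      rw [logShift, if_neg i.ne_zero]
      change (-(1 / (i : ℚ))) • dEnd (i : ℕ).toPNat' = _
      rw [PNat.coe_toPNat']
    rw [List.map_cons, List.prod_cons]
    change (logShift i : ConstOps).1 ((((l.map fun i : ℕ+ => logShift i).prod : ConstOps).1) v) = _
    rw [ih, h, map_smul, LinearMap.smul_apply, smul_smul]
    congr 1
    have : (i : ℚ) ≠ 0 := by exact_mod_cast i.ne_zero
    simp only [List.length_cons, List.map_cons, List.prod_cons]
    push_cast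
    rw [pow_succ]
    field_simp

lemma map_parts {r : ℕ} (c : Composition r) :
    (parts c).map (fun i : ℕ+ => (i : ℕ)) = c.blocks := by
  exact List.map_ofFn.trans c.ofFn_blocksFun

lemma length_parts {r : ℕ} (c : Composition r) : (parts c).length = c.length :=
  List.length_ofFn

/-- The coefficient of `yʳ` in the Miwa shift `f(x) ↦ f(x₁ - y, x₂ - y²/2, x₃ - y³/3, …)`. -/
def shiftOp (r : ℕ) : Module.End ℚ TimeSeries := (expCoeff logShift r : ConstOps).1

lemma eta_eq (v : TimeSeries) (r : ℕ) : eta v r = -shiftOp r v := by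
  have h : ∀ c : Composition r, (((c.blocks.map logShift).prod : ConstOps).1) v =
      ((-1 : ℚ) ^ c.length / (c.blocks.prod : ℚ)) • iterD (parts c) v := by
    intro c
    have := coe_prod_logShift (parts c) v
    rw [length_parts, map_parts, ← map_parts, List.map_map] at *
    exact this
  rw [eta, shiftOp, expCoeff, AddSubmonoidClass.coe_finsetSum, LinearMap.sum_apply,
    ← Finset.sum_neg_distrib]
  refine Finset.sum_congr rfl fun c _ => ?_
  change _ = -((1 / (c.length.factorial : ℚ)) • (((c.blocks.map logShift).prod : ConstOps).1) v)
  rw [h, smul_smul, ← neg_smul]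
  congr 1
  have := Nat.factorial_ne_zero c.length
  have : (c.length.factorial : ℚ) ≠ 0 := by exact_mod_cast this
  rw [pow_succ, div_mul_div_comm]
  ring

/-- `∂_j` indexed by `j : ℕ`, with the value `0` at `j = 0`. -/
def dNat (j : ℕ) : Derivation ℂ TimeSeries TimeSeries := if j = 0 then 0 else D j.toPNat'

@[simp] lemma dNat_zero : dNat 0 = 0 := by simp [dNat]

lemma dNat_coe (i : ℕ+) : dNat i = D i := by rw [dNat, if_neg i.ne_zero, PNat.coe_toPNat']

lemma shiftOp_zero (f : TimeSeries) : shiftOp 0 f = f := by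
  simp [shiftOp, expCoeff_zero]

/-- The differential equation y dT_y/dy = -∑ y^j ∂_j T_y. Together with the value at y = 0 it
determines T_y f. -/
lemma natCast_mul_shiftOp (r : ℕ) (f : TimeSeries) :
    (r : TimeSeries) * shiftOp r f = -∑ p ∈ antidiagonal r, dNat p.1 (shiftOp p.2 f) := by
  have h := congrArg (fun T : ConstOps => T.1 f) (smul_expCoeff logShift r)
  have h0 : ∀ p ∈ antidiagonal r,
      (((p.1 : ConstOps) * logShift p.1 * expCoeff logShift p.2 : ConstOps).1) f =
        -dNat p.1 (shiftOp p.2 f) := by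
    intro p _
    by_cases hp : p.1 ≠ 0
    · have h1 : ((p.1 : ConstOps) * logShift p.1).1 = -dEnd p.1.toPNat' := by
        have h2 : (p.1 : ℚ) ≠ 0 := by exact_mod_cast hp
        rw [← nsmul_eq_mul, ← Nat.cast_smul_eq_nsmul ℚ, logShift, if_neg hp, smul_smul]
        rw [mul_neg, mul_one_div_cancel h2, neg_smul, one_smul]
        rfl
      change ((p.1 : ConstOps) * logShift p.1).1 ((expCoeff logShift p.2 : ConstOps).1 f) = _
      rw [h1, dNat, if_neg hp]
      rfl
    · have : p.1 = 0 := by omega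
      simp [this]
  rw [← Finset.sum_neg_distrib, ← Finset.sum_congr rfl h0, ← nsmul_eq_mul]
  rw [← nsmul_eq_mul] at h
  refine Eq.trans h ?_
  change (∑ p ∈ antidiagonal r, _ : ConstOps).1 f = _
  rw [AddSubmonoidClass.coe_finsetSum, LinearMap.sum_apply]

lemma natCast_mul_cancel {r : ℕ} (hr : r ≠ 0) {f g : TimeSeries}
    (h : (r : TimeSeries) * f = r * g) : f = g := by
  rw [← nsmul_eq_mul, ← nsmul_eq_mul, ← Nat.cast_smul_eq_nsmul ℂ, ← Nat.cast_smul_eq_nsmul ℂ] at h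
  exact smul_right_injective _ (Nat.cast_ne_zero.mpr hr) h

lemma dNat_comm (i j : ℕ) (f : TimeSeries) : dNat i (dNat j f) = dNat j (dNat i f) := by
  unfold dNat
  split_ifs
  · rfl
  · rw [Derivation.coe_zero, Pi.zero_apply, Pi.zero_apply, map_zero]
  · rw [Derivation.coe_zero, Pi.zero_apply, Pi.zero_apply, map_zero]
  · exact D_comm _ _ _

lemma shiftOp_dNat (r i : ℕ) (f : TimeSeries) : shiftOp r (dNat i f) = dNat i (shiftOp r f) := by
  induction r using Nat.strong_induction_on generalizing f with
  | _ r ih =>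
    rcases Nat.eq_zero_or_pos r with rfl | hr
    · rw [shiftOp_zero, shiftOp_zero]
    · apply natCast_mul_cancel hr.ne'
      rw [natCast_mul_shiftOp, ← nsmul_eq_mul, ← map_nsmul, nsmul_eq_mul, natCast_mul_shiftOp,
        map_neg, map_sum]
      congr 1
      refine Finset.sum_congr rfl fun p hp => ?_
      have hp := mem_antidiagonal.mp hp
      rcases Nat.eq_zero_or_pos p.1 with h | h
      · simp [h]
      · rw [ih p.2 (by omega), dNat_comm]

lemma shiftOp_D (r : ℕ) (i : ℕ+) (f : TimeSeries) : shiftOp r (D i f) = D i (shiftOp r f) := by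
  rw [← dNat_coe, shiftOp_dNat]

/-- A sequence of power series solving the recursion of the Miwa shift is determined by its
initial term. -/
lemma eq_of_recursion {F G : ℕ → TimeSeries} (h0 : F 0 = G 0)
    (hF : ∀ r : ℕ, (r : TimeSeries) * F r = -∑ p ∈ antidiagonal r, dNat p.1 (F p.2))
    (hG : ∀ r : ℕ, (r : TimeSeries) * G r = -∑ p ∈ antidiagonal r, dNat p.1 (G p.2)) (r : ℕ) :
    F r = G r := by
  induction r using Nat.strong_induction_on with
  | _ r ih =>
    rcases Nat.eq_zero_or_pos r with rfl | hr
    · exact h0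
    · apply natCast_mul_cancel hr.ne'
      rw [hF, hG]
      congr 1
      refine Finset.sum_congr rfl fun p hp => ?_
      have hp := mem_antidiagonal.mp hp
      rcases Nat.eq_zero_or_pos p.1 with h | h
      · simp [h]
      · rw [ih p.2 (by omega)]

/-- T_y is a substitution, hence multiplicative. Formally, since the ∂_j are derivations, both sides
solve the same recursion. -/
lemma shiftOp_mul (r : ℕ) (f g : TimeSeries) :
    shiftOp r (f * g) = ∑ p ∈ antidiagonal r, shiftOp p.1 f * shiftOp p.2 g := by
  refine eq_of_recursion (F := fun r => shiftOp r (f * g))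
    (G := fun r => ∑ p ∈ antidiagonal r, shiftOp p.1 f * shiftOp p.2 g)
    (by simp [shiftOp_zero]) (fun r => natCast_mul_shiftOp r _) (fun r => ?_) r
  have e1 : ∑ p ∈ antidiagonal r, dNat p.1
      (∑ q ∈ antidiagonal p.2, shiftOp q.1 f * shiftOp q.2 g) =
      (∑ p ∈ antidiagonal r, ∑ q ∈ antidiagonal p.2,
        shiftOp q.1 f * dNat p.1 (shiftOp q.2 g)) +
      ∑ p ∈ antidiagonal r, ∑ q ∈ antidiagonal p.2,
        dNat p.1 (shiftOp q.1 f) * shiftOp q.2 g := by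
    rw [← Finset.sum_add_distrib]
    refine Finset.sum_congr rfl fun p _ => ?_
    rw [map_sum, ← Finset.sum_add_distrib]
    refine Finset.sum_congr rfl fun q _ => ?_
    rw [Derivation.leibniz, smul_eq_mul, smul_eq_mul]
    ring
  have e2 : ∑ p ∈ antidiagonal r, ∑ q ∈ antidiagonal p.2,
        dNat p.1 (shiftOp q.1 f) * shiftOp q.2 g =
      -∑ p ∈ antidiagonal r, (p.1 : TimeSeries) * shiftOp p.1 f * shiftOp p.2 g := by
    rw [sum_antidiagonal_assoc r fun a b c => dNat a (shiftOp b f) * shiftOp c g,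
      ← Finset.sum_neg_distrib]
    refine Finset.sum_congr rfl fun p _ => ?_
    rw [natCast_mul_shiftOp, ← Finset.sum_mul]
    ring
  have e3 : ∑ p ∈ antidiagonal r, ∑ q ∈ antidiagonal p.2,
        shiftOp q.1 f * dNat p.1 (shiftOp q.2 g) =
      -∑ p ∈ antidiagonal r, (p.2 : TimeSeries) * (shiftOp p.1 f * shiftOp p.2 g) := by
    rw [sum_antidiagonal_left_comm r fun a b c => shiftOp b f * dNat a (shiftOp c g),
      ← Finset.sum_neg_distrib]
    refine Finset.sum_congr rfl fun p _ => ?_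
    rw [← Finset.mul_sum, mul_left_comm, natCast_mul_shiftOp]
    ring
  rw [e1, e2, e3, Finset.mul_sum, neg_add, neg_neg, neg_neg, ← Finset.sum_add_distrib]
  refine Finset.sum_congr rfl fun p hp => ?_
  rw [← mem_antidiagonal.mp hp]
  push_cast
  ring

end ShiftOperators

/-! ### Equivalence of the hierarchy with linear equations for the Miwa shift -/

section LinearProblem

lemma natCast_succ_mul_shiftOp (m : ℕ) (f : TimeSeries) :
    ((m + 1 : ℕ) : TimeSeries) * shiftOp (m + 1) f =
      -∑ p ∈ antidiagonal m, D p.1.succPNat (shiftOp p.2 f) := by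
  rw [natCast_mul_shiftOp, Finset.Nat.sum_antidiagonal_succ, dNat_zero, Derivation.zero_apply,
    zero_add]
  rfl

lemma shiftOp_one (f : TimeSeries) : shiftOp 1 f = -D 1 f := by
  have := natCast_succ_mul_shiftOp 0 f
  have h1 : Nat.succPNat 0 = 1 := rfl
  simpa [shiftOp_zero, h1] using this

lemma shiftOp_apply_one {m : ℕ} (hm : m ≠ 0) : shiftOp m 1 = 0 := by
  induction m using Nat.strong_induction_on with
  | _ m ih =>
    apply natCast_mul_cancel hm
    rw [natCast_mul_shiftOp, mul_zero, neg_eq_zero]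
    refine Finset.sum_eq_zero fun p hp => ?_
    have hp := mem_antidiagonal.mp hp
    by_cases h1 : p.1 = 0
    · rw [h1, dNat_zero, Derivation.zero_apply]
    by_cases h2 : p.2 = 0
    · rw [h2, shiftOp_zero, Derivation.map_one_eq_zero]
    · rw [ih p.2 (by omega) h2, map_zero]

lemma xi_zero (v : TimeSeries) : xi v 0 = 1 := expCoeff_zero (eta v)

lemma natCast_mul_xi (v : TimeSeries) (r : ℕ) :
    (r : TimeSeries) * xi v r =
      ∑ p ∈ antidiagonal r, (p.1 : TimeSeries) * eta v p.1 * xi v p.2 :=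
  smul_expCoeff (eta v) r

lemma xi_one (v : TimeSeries) : xi v 1 = D 1 v := by
  have h := natCast_mul_xi v 1
  rw [Finset.Nat.sum_antidiagonal_succ] at h
  simpa [xi_zero, eta_eq, shiftOp_one] using h

/-- The coefficientwise form of the linear problem `b T_b ψ = (b - ∂ + ∂ log w(b)) ψ`, where `T_b`
is the Miwa shift. -/
def ShiftEquations (v : TimeSeries) : Prop :=
  ∀ m : ℕ, m ≠ 0 → ∀ b : ℕ,
    shiftOp (m + 1) (xi v b) - shiftOp m (xi v (b + 1)) = D 1 (eta v m) * xi v b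

lemma coeff_waveD (i : ℕ+) (f : WaveSeries) (n : ℤ) :
    (waveD i f).coeff n = D i (f.coeff n) + f.coeff (n + i) := by
  have h : k ^ (i : ℕ) = HahnSeries.single (-(i : ℤ)) (1 : TimeSeries) := by
    rw [k, HahnSeries.single_pow]; simp
  rw [waveD, HahnSeries.coeff_add, h]
  congr 1
  have := HahnSeries.coeff_single_mul_add (r := (1 : TimeSeries)) (x := f) (a := n + i)
    (b := -(i : ℤ))
  rw [add_neg_cancel_right, one_mul] at this
  exact this

lemma waveD_add (i : ℕ+) (f g : WaveSeries) : waveD i (f + g) = waveD i f + waveD i g := by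
  ext1; funext n
  simp only [coeff_waveD, HahnSeries.coeff_add, map_add]
  abel

lemma waveD_smul (i : ℕ+) (a : TimeSeries) (f : WaveSeries) :
    waveD i (a • f) = a • waveD i f + D i a • f := by
  ext1; funext n
  simp only [coeff_waveD, HahnSeries.coeff_add, HahnSeries.coeff_smul, smul_eq_mul,
    Derivation.leibniz]
  ring

lemma waveD_zero (i : ℕ+) : waveD i 0 = 0 := by
  ext1; funext n
  simp [coeff_waveD]

lemma waveD_neg (i : ℕ+) (f : WaveSeries) : waveD i (-f) = -waveD i f := by
  ext1; funext n
  simp only [coeff_waveD, HahnSeries.coeff_neg, map_neg]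
  abel

lemma waveD_comm (i j : ℕ+) (f : WaveSeries) : waveD i (waveD j f) = waveD j (waveD i f) := by
  ext1; funext n
  simp only [coeff_waveD, map_add, D_comm i j, add_right_comm n (i : ℤ)]
  abel

/-- The action of the coefficients of the Miwa shift on formal functions `exp (∑ x_j kʲ) f`,
written on the factor `f`. -/
def waveShift : ℕ → WaveSeries → WaveSeries
  | 0, f => f
  | m + 1, f => f.map (shiftOp (m + 1)) - k * f.map (shiftOp m)

lemma coeff_waveShift_succ (m : ℕ) (f : WaveSeries) (n : ℤ) :
    (waveShift (m + 1) f).coeff n =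
      shiftOp (m + 1) (f.coeff n) - shiftOp m (f.coeff (n + 1)) := by
  rw [waveShift, HahnSeries.coeff_sub, k]
  congr 1
  have := HahnSeries.coeff_single_mul_add (r := (1 : TimeSeries)) (x := f.map (shiftOp m))
    (a := n + 1) (b := (-1 : ℤ))
  rw [add_neg_cancel_right, one_mul] at this
  exact this

lemma coeff_sum_wave {ι : Type*} (s : Finset ι) (F : ι → WaveSeries) (n : ℤ) :
    (∑ i ∈ s, F i).coeff n = ∑ i ∈ s, (F i).coeff n :=
  map_sum (HahnSeries.coeff.addMonoidHom n) F s

/-- The operator (1 - yk) T_y is T_y conjugated by exp(∑ x_j k^j), so it satisfies the recursion of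
T_y with each ∂_j replaced by its conjugate `waveD j`. -/
lemma smul_waveShift (m : ℕ) (f : WaveSeries) :
    ((m + 1 : ℕ) : TimeSeries) • waveShift (m + 1) f =
      -∑ p ∈ antidiagonal m, waveD p.1.succPNat (waveShift p.2 f) := by
  ext1; funext n
  rw [HahnSeries.coeff_smul, smul_eq_mul, coeff_waveShift_succ, mul_sub, natCast_succ_mul_shiftOp,
    HahnSeries.coeff_neg, coeff_sum_wave]
  cases m with
  | zero =>
    simp [coeff_waveD, waveShift, shiftOp_zero]
    ring
  | succ m =>
    have e := natCast_succ_mul_shiftOp m (f.coeff (n + 1))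
    -- The contributions of the factors k^j telescope: `t` and `t'` peel the same sum at its two
    -- ends.
    have t := Finset.Nat.sum_antidiagonal_succ (n := m)
      (f := fun p : ℕ × ℕ => shiftOp p.2 (f.coeff (n + p.1 + 1)))
    have t' := Finset.Nat.sum_antidiagonal_succ' (n := m)
      (f := fun p : ℕ × ℕ => shiftOp p.2 (f.coeff (n + p.1 + 1)))
    rw [Finset.Nat.sum_antidiagonal_succ', Finset.Nat.sum_antidiagonal_succ']
    simp only [coeff_waveD, coeff_waveShift_succ, map_sub, Finset.sum_add_distrib,
      Finset.sum_sub_distrib]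
    simp only [waveShift, shiftOp_zero, Nat.succPNat_coe] at t t' ⊢
    simp only [Nat.succ_eq_add_one, Nat.cast_add, Nat.cast_one, Nat.cast_zero, add_zero,
      ← add_assoc] at e t t' ⊢
    linear_combination -e + t - t'

/-- The span of the first `n` derivatives `ψ, ∂ψ, …, ∂ⁿ⁻¹ψ`. -/
def derivSpan (w : WaveSeries) (n : ℕ) : Submodule TimeSeries WaveSeries :=
  Submodule.span TimeSeries ((fun i => (waveD 1)^[i] w) '' Set.Iio n)

lemma derivSpan_mono (w : WaveSeries) {m n : ℕ} (h : m ≤ n) : derivSpan w m ≤ derivSpan w n :=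
  Submodule.span_mono (Set.image_mono (Set.Iio_subset_Iio h))

lemma iterate_mem_derivSpan (w : WaveSeries) {i n : ℕ} (h : i < n) :
    (waveD 1)^[i] w ∈ derivSpan w n :=
  Submodule.subset_span ⟨i, h, rfl⟩

lemma mem_derivSpan_succ {w f : WaveSeries} {n : ℕ} (h : f ∈ derivSpan w (n + 1)) :
    ∃ A : TimeSeries, ∃ g ∈ derivSpan w n, f = A • (waveD 1)^[n] w + g := by
  have : Set.Iio (n + 1) = insert n (Set.Iio n) := by
    ext i; simp only [Set.mem_Iio, Set.mem_insert_iff]; omega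
  rw [derivSpan, this, Set.image_insert_eq] at h
  exact Submodule.mem_span_insert.mp h

lemma waveD_one_mem_derivSpan {w f : WaveSeries} {n : ℕ} (h : f ∈ derivSpan w n) :
    waveD 1 f ∈ derivSpan w (n + 1) := by
  induction h using Submodule.span_induction with
  | mem x hx =>
    obtain ⟨i, hi, rfl⟩ := hx
    change waveD 1 ((waveD 1)^[i] w) ∈ _
    rw [← Function.iterate_succ_apply' (waveD 1)]
    exact iterate_mem_derivSpan w (Nat.succ_lt_succ hi)
  | zero => rw [waveD_zero]; exact zero_mem _
  | add x y _ _ hx hy => rw [waveD_add]; exact add_mem hx hy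
  | smul a x hx hx' =>
    rw [waveD_smul]
    exact add_mem (Submodule.smul_mem _ _ hx')
      (Submodule.smul_mem _ _ (derivSpan_mono w (Nat.le_succ n) hx))

lemma exists_sum_of_mem_derivSpan {w f : WaveSeries} {n : ℕ} (h : f ∈ derivSpan w n) :
    ∃ A : ℕ → TimeSeries, f = ∑ i ∈ range n, A i • (waveD 1)^[i] w := by
  induction n generalizing f with
  | zero =>
    refine ⟨0, ?_⟩
    simpa [derivSpan] using h
  | succ n ih =>
    obtain ⟨a, g, hg, rfl⟩ := mem_derivSpan_succ h
    obtain ⟨A, rfl⟩ := ih hg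
    refine ⟨fun i => if i = n then a else A i, ?_⟩
    simp only [Finset.sum_range_succ, if_true]
    rw [add_comm]
    congr 1
    refine Finset.sum_congr rfl fun i hi => ?_
    rw [if_neg (Finset.mem_range.mp hi).ne]

lemma coeff_wave_natCast (v : TimeSeries) (n : ℕ) : (wave v).coeff (n : ℤ) = xi v n := by
  rw [wave, HahnSeries.ofPowerSeries_apply_coeff, PowerSeries.coeff_mk]

lemma coeff_wave_of_neg (v : TimeSeries) {n : ℤ} (h : n < 0) : (wave v).coeff n = 0 := by
  rw [wave, HahnSeries.ofPowerSeries_apply]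
  apply HahnSeries.embDomain_of_notMem_range
  rintro ⟨m, rfl⟩
  simp at h
  omega

lemma coeff_iterate_waveD_of_lt (v : TimeSeries) (i : ℕ) {n : ℤ} (h : n < -i) :
    ((waveD 1)^[i] (wave v)).coeff n = 0 := by
  induction i generalizing n with
  | zero => exact coeff_wave_of_neg v (by simpa using h)
  | succ i ih =>
    push_cast at h
    rw [Function.iterate_succ_apply', coeff_waveD, ih (by omega), ih (by rw [PNat.one_coe]; omega)]
    simp

lemma coeff_iterate_waveD_self (v : TimeSeries) (i : ℕ) :
    ((waveD 1)^[i] (wave v)).coeff (-i) = 1 := by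
  induction i with
  | zero =>
    have := coeff_wave_natCast v 0
    rw [xi_zero] at this
    simpa using this
  | succ i ih =>
    rw [Function.iterate_succ_apply', coeff_waveD, coeff_iterate_waveD_of_lt v i (by omega)]
    have : -((i + 1 : ℕ) : ℤ) + ((1 : ℕ+) : ℕ) = -i := by rw [PNat.one_coe]; omega
    rw [this, ih]
    simp

lemma coeff_of_mem_derivSpan {v : TimeSeries} {f : WaveSeries} {n : ℕ}
    (h : f ∈ derivSpan (wave v) n) {l : ℤ} (hl : l ≤ -n) : f.coeff l = 0 := by
  induction h using Submodule.span_induction with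
  | mem x hx =>
    obtain ⟨i, hi, rfl⟩ := hx
    have := Set.mem_Iio.mp hi
    exact coeff_iterate_waveD_of_lt v i (by omega)
  | zero => rfl
  | add x y _ _ hx hy => rw [HahnSeries.coeff_add, hx, hy, add_zero]
  | smul a x _ hx => rw [HahnSeries.coeff_smul, hx, smul_zero]

/-- The factor of ∂^i ψ starts with k^i and coefficient 1, so the absence of positive powers of k
forces the coefficients of all ∂^i ψ with i > 0 to vanish, from the top down. -/
lemma eq_smul_wave {v : TimeSeries} {f : WaveSeries} {n : ℕ} (h : f ∈ derivSpan (wave v) n)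
    (hf : ∀ l : ℤ, l < 0 → f.coeff l = 0) : f = f.coeff 0 • wave v := by
  induction n generalizing f with
  | zero =>
    have : f = 0 := by simpa [derivSpan] using h
    rw [this]
    exact (zero_smul TimeSeries (wave v)).symm
  | succ n ih =>
    obtain ⟨a, g, hg, rfl⟩ := mem_derivSpan_succ h
    have hc : (a • (waveD 1)^[n] (wave v) + g).coeff (-n) = a := by
      rw [HahnSeries.coeff_add, HahnSeries.coeff_smul, coeff_iterate_waveD_self,
        coeff_of_mem_derivSpan hg le_rfl, smul_eq_mul, mul_one, add_zero]
    rcases Nat.eq_zero_or_pos n with rfl | hn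
    · have hg0 : g = 0 := by simpa [derivSpan] using hg
      rw [Nat.cast_zero, neg_zero] at hc
      rw [hc, hg0, add_zero]
      rfl
    · have ha : a = 0 := by rw [← hc]; exact hf _ (by omega)
      have hg' : a • (waveD 1)^[n] (wave v) + g = g := by
        rw [ha]
        exact (congrArg (· + g) (zero_smul TimeSeries _)).trans (zero_add g)
      rw [hg'] at hf ⊢
      exact ih hg hf

/-- The span of all derivatives `∂ⁱψ`. -/
def fullSpan (w : WaveSeries) : Submodule TimeSeries WaveSeries :=
  Submodule.span TimeSeries (Set.range fun i => (waveD 1)^[i] w)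

lemma derivSpan_le_fullSpan (w : WaveSeries) (n : ℕ) : derivSpan w n ≤ fullSpan w :=
  Submodule.span_mono (Set.image_subset_range _ _)

lemma exists_mem_derivSpan {w f : WaveSeries} (h : f ∈ fullSpan w) : ∃ n, f ∈ derivSpan w n := by
  induction h using Submodule.span_induction with
  | mem x hx =>
    obtain ⟨i, rfl⟩ := hx
    exact ⟨i + 1, iterate_mem_derivSpan w (Nat.lt_succ_self i)⟩
  | zero => exact ⟨0, zero_mem _⟩
  | add x y _ _ hx hy =>
    obtain ⟨m, hm⟩ := hx
    obtain ⟨n, hn⟩ := hy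
    exact ⟨max m n, add_mem (derivSpan_mono w (le_max_left m n) hm)
      (derivSpan_mono w (le_max_right m n) hn)⟩
  | smul a x _ hx =>
    obtain ⟨m, hm⟩ := hx
    exact ⟨m, Submodule.smul_mem _ _ hm⟩

lemma iterate_waveD_mem_fullSpan {w f : WaveSeries} (h : f ∈ fullSpan w) (j : ℕ) :
    (waveD 1)^[j] f ∈ fullSpan w := by
  induction j with
  | zero => exact h
  | succ j ih =>
    obtain ⟨n, hn⟩ := exists_mem_derivSpan ih
    rw [Function.iterate_succ_apply']
    exact derivSpan_le_fullSpan w _ (waveD_one_mem_derivSpan hn)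

lemma iterate_waveD_comm (i : ℕ+) (j : ℕ) (f : WaveSeries) :
    waveD i ((waveD 1)^[j] f) = (waveD 1)^[j] (waveD i f) := by
  induction j with
  | zero => rfl
  | succ j ih => rw [Function.iterate_succ_apply', waveD_comm, ih, Function.iterate_succ_apply']

lemma waveD_mem_fullSpan {v : TimeSeries} (hv : IsSolution v) (i : ℕ+) {f : WaveSeries}
    (h : f ∈ fullSpan (wave v)) : waveD i f ∈ fullSpan (wave v) := by
  have hi : ∀ j, (waveD 1)^[j] (wave v) ∈ fullSpan (wave v) := fun j =>
    Submodule.subset_span ⟨j, rfl⟩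
  induction h using Submodule.span_induction with
  | mem x hx =>
    obtain ⟨j, rfl⟩ := hx
    change waveD i ((waveD 1)^[j] (wave v)) ∈ _
    rw [iterate_waveD_comm]
    apply iterate_waveD_mem_fullSpan
    obtain ⟨B, hB⟩ := hv i
    rw [hB]
    refine add_mem (hi _) (sum_mem fun l _ => ?_)
    rw [HahnSeries.C_mul_eq_smul]
    exact Submodule.smul_mem _ _ (hi _)
  | zero => rw [waveD_zero]; exact zero_mem _
  | add x y _ _ hx hy => rw [waveD_add]; exact add_mem hx hy
  | smul a x hx hx' =>
    rw [waveD_smul]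
    exact add_mem (Submodule.smul_mem _ _ hx') (Submodule.smul_mem _ _ hx)

lemma mem_of_natCast_smul_mem {N : Submodule TimeSeries WaveSeries} {m : ℕ} (hm : m ≠ 0)
    {f : WaveSeries} (h : (m : TimeSeries) • f ∈ N) : f ∈ N := by
  have : (MvPowerSeries.C (m : ℂ)⁻¹ : TimeSeries) • (m : TimeSeries) • f = f := by
    rw [smul_smul, ← map_natCast (MvPowerSeries.C (σ := ℕ+) (R := ℂ)) m, ← map_mul,
      inv_mul_cancel₀ (Nat.cast_ne_zero.mpr hm), map_one, one_smul]
  rw [← this]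
  exact Submodule.smul_mem _ _ h

lemma waveShift_mem_fullSpan {v : TimeSeries} (hv : IsSolution v) (m : ℕ) :
    waveShift m (wave v) ∈ fullSpan (wave v) := by
  induction m using Nat.strong_induction_on with
  | _ m ih =>
    cases m with
    | zero => exact Submodule.subset_span ⟨0, rfl⟩
    | succ m =>
      apply mem_of_natCast_smul_mem (Nat.succ_ne_zero m)
      rw [smul_waveShift]
      refine neg_mem (sum_mem fun p hp => waveD_mem_fullSpan hv _ (ih _ ?_))
      have := mem_antidiagonal.mp hp
      omega

/-- The only positive power of k in (1 - yk) T_y w comes from -yk times the constant term 1 of w,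
and it has order exactly 1 in y. -/
lemma coeff_waveShift_wave_of_neg (v : TimeSeries) {m : ℕ} (hm : m ≠ 0) {l : ℤ} (hl : l < 0) :
    (waveShift (m + 1) (wave v)).coeff l = 0 := by
  rw [coeff_waveShift_succ, coeff_wave_of_neg v hl, map_zero, zero_sub, neg_eq_zero]
  rcases (show l + 1 ≤ 0 by omega).lt_or_eq with h | h
  · rw [coeff_wave_of_neg v h, map_zero]
  · have := coeff_wave_natCast v 0
    rw [xi_zero, Nat.cast_zero] at this
    rw [h, this, shiftOp_apply_one hm]

lemma coeff_zero_waveShift_wave (v : TimeSeries) (m : ℕ) :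
    (waveShift (m + 1) (wave v)).coeff 0 = D 1 (eta v m) := by
  have h0 := coeff_wave_natCast v 0
  have h1 := coeff_wave_natCast v 1
  rw [xi_zero, Nat.cast_zero] at h0
  rw [xi_one, Nat.cast_one] at h1
  rw [coeff_waveShift_succ, zero_add, h0, h1, shiftOp_apply_one (Nat.succ_ne_zero m), zero_sub,
    eta_eq, shiftOp_D, map_neg]

/-- The coefficient of T_y ψ lies in the span of the ∂^i ψ and has no positive powers of k, so it is
a multiple of ψ; the multiplier is its coefficient at k^0. -/
lemma IsSolution.shiftEquations {v : TimeSeries} (hv : IsSolution v) : ShiftEquations v := by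
  intro m hm b
  obtain ⟨n, hn⟩ := exists_mem_derivSpan (waveShift_mem_fullSpan hv (m + 1))
  have h := eq_smul_wave hn fun l hl => coeff_waveShift_wave_of_neg v hm hl
  rw [coeff_zero_waveShift_wave v m] at h
  have := congrArg (fun f : WaveSeries => f.coeff (b : ℤ)) h
  simp only [coeff_waveShift_succ, HahnSeries.coeff_smul, smul_eq_mul] at this
  rw [← Nat.cast_succ, coeff_wave_natCast, coeff_wave_natCast] at this
  exact this

lemma ShiftEquations.waveShift_wave {v : TimeSeries} (hv : ShiftEquations v) {m : ℕ} (hm : m ≠ 0) :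
    waveShift (m + 1) (wave v) = D 1 (eta v m) • wave v := by
  ext1; funext l
  rcases lt_or_ge l 0 with hl | hl
  · rw [coeff_waveShift_wave_of_neg v hm hl, HahnSeries.coeff_smul, coeff_wave_of_neg v hl,
      smul_zero]
  · lift l to ℕ using hl
    rw [coeff_waveShift_succ, HahnSeries.coeff_smul, smul_eq_mul, ← Nat.cast_succ,
      coeff_wave_natCast, coeff_wave_natCast]
    exact hv m hm l

lemma waveShift_one (f : WaveSeries) : waveShift 1 f = -waveD 1 f := by
  have := smul_waveShift 0 f
  have h1 : Nat.succPNat 0 = 1 := rfl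
  simpa [waveShift, h1] using this

/-- The recursion of `smul_waveShift` expresses the newest time derivative of ψ through earlier
ones, because the shifted terms of order at least 2 in y are multiples of ψ. -/
lemma ShiftEquations.waveD_sub_mem {v : TimeSeries} (hv : ShiftEquations v) (n : ℕ) :
    waveD n.succPNat (wave v) - (waveD 1)^[n + 1] (wave v) ∈ derivSpan (wave v) n := by
  induction n using Nat.strong_induction_on with
  | _ n ih =>
    cases n with
    | zero =>
      have : Nat.succPNat 0 = 1 := rfl
      simp [this]
    | succ n =>
      set w := wave v with hw
      have hmem : ∀ a : TimeSeries, a • w ∈ derivSpan w (n + 1) := fun a =>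
        Submodule.smul_mem _ _ (iterate_mem_derivSpan w (Nat.succ_pos n))
      have h := smul_waveShift (n + 1) w
      rw [hv.waveShift_wave (Nat.succ_ne_zero n), Finset.Nat.sum_antidiagonal_succ'] at h
      -- The term of order 1 in y is -∂_{n+1} ∂ψ and cancels against the added ∂ ∂_{n+1} ψ; what
      -- remains has order at most n.
      have h1 : ∑ p ∈ antidiagonal n, waveD p.1.succPNat (waveShift (p.2 + 1) w) +
          waveD 1 (waveD n.succPNat w) ∈ derivSpan w (n + 1) := by
        cases n with
        | zero =>
          rw [Finset.Nat.antidiagonal_zero, Finset.sum_singleton, waveShift_one, waveD_neg,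
            waveD_comm 1, neg_add_cancel]
          exact zero_mem _
        | succ n =>
          rw [Finset.Nat.sum_antidiagonal_succ', waveShift_one, waveD_neg, waveD_comm 1]
          change -waveD (n + 1).succPNat (waveD 1 w) + _ + _ ∈ _
          rw [neg_add_eq_sub, sub_add_cancel]
          refine sum_mem fun p hp => ?_
          have hp := mem_antidiagonal.mp hp
          rw [hv.waveShift_wave (Nat.succ_ne_zero _), waveD_smul]
          refine add_mem (Submodule.smul_mem _ _ ?_) (hmem _)
          have h2 := derivSpan_mono w (show p.1 ≤ n + 1 + 1 by omega) (ih p.1 (by omega))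
          have h3 := iterate_mem_derivSpan w (show p.1 + 1 < n + 1 + 1 by omega)
          simpa using add_mem h2 h3
      have h4 := waveD_one_mem_derivSpan (ih n (Nat.lt_succ_self n))
      rw [sub_eq_add_neg, waveD_add, waveD_neg,
        ← Function.iterate_succ_apply' (waveD 1)] at h4
      have h5 := sub_mem h4 (add_mem h1 (Submodule.smul_mem _ ((n + 1 + 1 : ℕ) : TimeSeries)
        (hmem (D 1 (eta v (n + 1))))))
      rw [h] at h5
      convert h5 using 1
      simp only [waveShift]
      abel

lemma ShiftEquations.isSolution {v : TimeSeries} (hv : ShiftEquations v) : IsSolution v := by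
  intro n
  obtain ⟨n, rfl⟩ : ∃ m : ℕ, n = m.succPNat := ⟨n.natPred, n.succPNat_natPred.symm⟩
  obtain ⟨A, hA⟩ := exists_sum_of_mem_derivSpan (hv.waveD_sub_mem n)
  -- For time index n + 1 the remainder has orders 0, ..., n - 1, which are the n + 1 - i with 2 ≤ i
  -- ≤ n + 1.
  refine ⟨fun i => A (n + 1 - i), ?_⟩
  rw [sub_eq_iff_eq_add'.mp hA, Nat.succPNat_coe]
  congr 1
  refine Finset.sum_nbij' (fun i => n + 1 - i) (fun i => n + 1 - i) ?_ ?_ ?_ ?_ ?_ <;>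
    simp only [Finset.mem_range, Finset.mem_Icc]
  · intro i hi; omega
  · intro i hi; omega
  · intro i hi; omega
  · intro i hi; omega
  · intro i hi
    rw [HahnSeries.C_mul_eq_smul, show n + 1 - (n + 1 - i) = i by omega]

end LinearProblem

/-! ### Logarithmic differentiation and the reduction of S_a S_b v -/

section Recursion

/-- The coefficient of `yᵃzᵇ` in `T_y w(z) / w(z)` for a solution `v`. -/
def shiftRatio (v : TimeSeries) (a b : ℕ) : TimeSeries :=
  if a = 0 then (if b = 0 then 1 else 0) else if b = 0 then 0 else -D 1 (eta v (a + b - 1))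

/-- The power series `∑ S_a(f_b) zᵇ`, where `S_a` is a coefficient of the Miwa shift. -/
def shiftSeries (a : ℕ) (f : PowerSeries TimeSeries) : PowerSeries TimeSeries :=
  PowerSeries.mk fun b => shiftOp a (PowerSeries.coeff b f)

lemma shiftSeries_mul (a : ℕ) (f g : PowerSeries TimeSeries) :
    shiftSeries a (f * g) = ∑ p ∈ antidiagonal a, shiftSeries p.1 f * shiftSeries p.2 g := by
  ext1 b
  simp only [shiftSeries, PowerSeries.coeff_mk, PowerSeries.coeff_mul, map_sum, shiftOp_mul]
  exact Finset.sum_comm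

/-- The Euler operator `z d/dz`. -/
def euler (f : PowerSeries TimeSeries) : PowerSeries TimeSeries :=
  PowerSeries.mk fun b => (b : TimeSeries) * PowerSeries.coeff b f

lemma euler_mul (f g : PowerSeries TimeSeries) : euler (f * g) = euler f * g + f * euler g := by
  ext1 b
  simp only [euler, PowerSeries.coeff_mk, PowerSeries.coeff_mul, map_add, Finset.mul_sum,
    ← Finset.sum_add_distrib]
  refine Finset.sum_congr rfl fun p hp => ?_
  rw [← mem_antidiagonal.mp hp]
  push_cast
  ring

lemma shiftSeries_euler (a : ℕ) (f : PowerSeries TimeSeries) :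
    shiftSeries a (euler f) = euler (shiftSeries a f) := by
  ext1 b
  simp only [euler, shiftSeries, PowerSeries.coeff_mk]
  rw [← nsmul_eq_mul, map_nsmul, nsmul_eq_mul]

lemma sum_antidiagonal_ite (h : ℕ → TimeSeries) (g : ℕ → TimeSeries) (b : ℕ) :
    ∑ p ∈ antidiagonal b, (if p.1 = 0 then 0 else h p.1) * g p.2 =
      ∑ p ∈ antidiagonal b, h p.1 * g p.2 - h 0 * g b := by
  cases b with
  | zero => simp
  | succ b =>
    rw [Finset.Nat.sum_antidiagonal_succ, Finset.Nat.sum_antidiagonal_succ]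
    simp

/-- The shift equations reduce S_a ξ_{b+1} to S_{a+1} ξ_b, so the induction on b must keep a
arbitrary. -/
lemma ShiftEquations.shiftOp_xi {v : TimeSeries} (hv : ShiftEquations v) (a b : ℕ) :
    shiftOp a (xi v b) = ∑ p ∈ antidiagonal b, shiftRatio v a p.1 * xi v p.2 := by
  rcases Nat.eq_zero_or_pos a with rfl | ha
  · rw [shiftOp_zero, Finset.sum_eq_single (0, b)]
    · simp [shiftRatio]
    · rintro ⟨p, q⟩ hp hne
      have := mem_antidiagonal.mp hp
      have : p ≠ 0 := by rintro rfl; apply hne; simp_all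
      simp [shiftRatio, this]
    · intro h; exact (h (by simp)).elim
  · induction b generalizing a with
    | zero => simp [shiftRatio, ha.ne', xi_zero, shiftOp_apply_one ha.ne']
    | succ b ih =>
      have h := hv a ha.ne' b
      rw [ih (a + 1) (Nat.succ_pos a)] at h
      rw [← sub_eq_iff_eq_add'.mpr (sub_eq_iff_eq_add.mp h), Finset.Nat.sum_antidiagonal_succ]
      simp only [shiftRatio, ha.ne', Nat.succ_ne_zero, if_false, if_true, zero_mul, zero_add]
      rw [sum_antidiagonal_ite (fun p => -D 1 (eta v (a + 1 + p - 1))) (xi v) b]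
      simp only [show ∀ p, a + 1 + p - 1 = a + (p + 1) - 1 from fun p => by omega]
      simp

lemma shiftRatio_series {v : TimeSeries} (hv : ShiftEquations v) (a : ℕ) :
    shiftSeries a (PowerSeries.mk (xi v)) =
      PowerSeries.mk (shiftRatio v a) * PowerSeries.mk (xi v) := by
  ext1 b
  simp only [shiftSeries, PowerSeries.coeff_mk, PowerSeries.coeff_mul]
  exact hv.shiftOp_xi a b

lemma euler_xi (v : TimeSeries) :
    euler (PowerSeries.mk (xi v)) = euler (PowerSeries.mk (eta v)) * PowerSeries.mk (xi v) := by
  ext1 b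
  simp only [euler, PowerSeries.coeff_mk, PowerSeries.coeff_mul]
  exact natCast_mul_xi v b

/-- Apply z d/dz to log(T_y w / w) = T_y log w - log w. The term of order 0 in y on the right is log
w itself and cancels, which leaves the indices p.1 + 1. -/
lemma euler_shiftRatio {v : TimeSeries} (hv : ShiftEquations v) (a : ℕ) :
    euler (PowerSeries.mk (shiftRatio v (a + 1))) =
      ∑ p ∈ antidiagonal a, euler (shiftSeries (p.1 + 1) (PowerSeries.mk (eta v))) *
        PowerSeries.mk (shiftRatio v p.2) := by
  -- The constant term of w is 1, so w can be cancelled in place of dividing by it.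
  have hw : IsUnit (PowerSeries.mk (xi v)) := by
    rw [PowerSeries.isUnit_iff_constantCoeff, ← PowerSeries.coeff_zero_eq_constantCoeff_apply,
      PowerSeries.coeff_mk, xi_zero]
    exact isUnit_one
  have h := congrArg (shiftSeries (a + 1)) (euler_xi v)
  rw [shiftSeries_euler, shiftRatio_series hv, euler_mul, euler_xi, shiftSeries_mul] at h
  simp only [shiftSeries_euler, shiftRatio_series hv] at h
  simp only [← mul_assoc, ← Finset.sum_mul, ← add_mul] at h
  have h := hw.mul_right_cancel h
  rw [Finset.Nat.sum_antidiagonal_succ] at h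
  have h0 : shiftSeries 0 (PowerSeries.mk (eta v)) = PowerSeries.mk (eta v) := by
    ext1 b; simp [shiftSeries, shiftOp_zero]
  rw [h0, mul_comm (PowerSeries.mk (shiftRatio v (a + 1))), add_comm] at h
  exact add_left_cancel h

/-- The erased index (a, 0) carries the constant 1 of the ratio and yields S_{a+1} η_b. In all other
terms the ratio contributes either 0 or a factor -∂η, so they are products of factors of smaller
weight. -/
lemma natCast_mul_shiftOp_shiftOp {v : TimeSeries} (hv : ShiftEquations v) (a : ℕ) {b : ℕ}
    (hb : b ≠ 0) :
    (b : TimeSeries) * shiftOp (a + 1) (shiftOp b v) = b * D 1 (eta v (a + b)) +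
      ∑ p ∈ (antidiagonal a).erase (a, 0), ∑ q ∈ antidiagonal b,
        (q.1 : TimeSeries) * shiftOp (p.1 + 1) (eta v q.1) * shiftRatio v p.2 q.2 := by
  have h := congrArg (PowerSeries.coeff b) (euler_shiftRatio hv a)
  simp only [euler, shiftSeries, PowerSeries.coeff_mk, map_sum, PowerSeries.coeff_mul] at h
  rw [← Finset.add_sum_erase (antidiagonal a) _ (show (a, 0) ∈ antidiagonal a by simp),
    Finset.sum_eq_single (b, 0)] at h
  · simp only [shiftRatio, Nat.succ_ne_zero, hb, if_false, if_true, mul_one] at h ⊢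
    rw [show a + 1 + b - 1 = a + b by omega] at h
    have e : shiftOp (a + 1) (eta v b) = -shiftOp (a + 1) (shiftOp b v) := by
      rw [eta_eq, map_neg]
    rw [e] at h
    linear_combination h
  · rintro ⟨p, q⟩ hp hne
    have := mem_antidiagonal.mp hp
    have : q ≠ 0 := by rintro rfl; apply hne; simp_all
    simp [shiftRatio, this]
  · intro h; exact (h (by simp)).elim

end Recursion

/-! ### Existence of universal polynomials by induction on the weight -/

section Universality

/-- The weight `s + t` of a column. -/
abbrev colWeight (c : Column) : ℕ := (c.1 + c.2 : ℕ)

/-- `F v` is given, for all formal solutions `v`, by a universal homogeneous polynomial of weight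
`N` in the functions attached to the columns. -/
def IsJetPoly (N : ℕ) (F : TimeSeries → TimeSeries) : Prop :=
  ∃ P : MvPolynomial Column ℚ, P.IsWeightedHomogeneous colWeight N ∧
    ∀ v, IsSolution v → F v = MvPolynomial.aeval (jet v) P

namespace IsJetPoly

variable {M N : ℕ} {F G : TimeSeries → TimeSeries}

lemma congr (hF : IsJetPoly N F) (h : ∀ v, IsSolution v → G v = F v) : IsJetPoly N G := by
  obtain ⟨P, hP, hF⟩ := hF
  exact ⟨P, hP, fun v hv => (h v hv).trans (hF v hv)⟩

lemma of_weight_eq (hF : IsJetPoly M F) (h : M = N) : IsJetPoly N F := h ▸ hF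

lemma zero (N : ℕ) : IsJetPoly N fun _ => 0 :=
  ⟨0, MvPolynomial.isWeightedHomogeneous_zero _ _ _, fun v _ => by simp⟩

lemma add (hF : IsJetPoly N F) (hG : IsJetPoly N G) : IsJetPoly N fun v => F v + G v := by
  obtain ⟨P, hP, hF⟩ := hF
  obtain ⟨Q, hQ, hG⟩ := hG
  exact ⟨P + Q, hP.add hQ, fun v hv => by simp only [map_add, hF v hv, hG v hv]⟩

lemma smul (q : ℚ) (hF : IsJetPoly N F) : IsJetPoly N fun v => q • F v := by
  obtain ⟨P, hP, hF⟩ := hF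
  refine ⟨MvPolynomial.C q * P, hP.C_mul q, fun v hv => ?_⟩
  simp only [hF v hv, map_mul, MvPolynomial.aeval_C, Algebra.smul_def]

lemma neg (hF : IsJetPoly N F) : IsJetPoly N fun v => -F v :=
  (hF.smul (-1)).congr fun v _ => by simp

lemma natCast_mul (n : ℕ) (hF : IsJetPoly N F) : IsJetPoly N fun v => (n : TimeSeries) * F v :=
  (hF.smul n).congr fun v _ => by rw [Nat.cast_smul_eq_nsmul, nsmul_eq_mul]

lemma of_natCast_mul {n : ℕ} (hn : n ≠ 0) (hF : IsJetPoly N fun v => (n : TimeSeries) * F v) :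
    IsJetPoly N F :=
  (hF.smul (n : ℚ)⁻¹).congr fun v _ => by
    rw [← nsmul_eq_mul, ← Nat.cast_smul_eq_nsmul ℚ, smul_smul,
      inv_mul_cancel₀ (Nat.cast_ne_zero.mpr hn), one_smul]

lemma mul (hF : IsJetPoly M F) (hG : IsJetPoly N G) : IsJetPoly (M + N) fun v => F v * G v := by
  obtain ⟨P, hP, hF⟩ := hF
  obtain ⟨Q, hQ, hG⟩ := hG
  exact ⟨P * Q, hP.mul hQ, fun v hv => by simp only [map_mul, hF v hv, hG v hv]⟩

lemma sum {ι : Type*} (s : Finset ι) {F : ι → TimeSeries → TimeSeries}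
    (h : ∀ i ∈ s, IsJetPoly N (F i)) : IsJetPoly N fun v => ∑ i ∈ s, F i v := by
  classical
  induction s using Finset.induction_on with
  | empty => simpa using zero N
  | insert i s hi ih =>
    simp only [Finset.sum_insert hi]
    exact (h i (Finset.mem_insert_self i s)).add
      (ih fun j hj => h j (Finset.mem_insert_of_mem hj))

lemma jet (c : Column) : IsJetPoly (colWeight c) fun v => KP.jet v c :=
  ⟨MvPolynomial.X c, MvPolynomial.isWeightedHomogeneous_X _ _ _, fun v _ => by simp⟩

lemma monomial (m : Column →₀ ℕ) : IsJetPoly (Finsupp.weight colWeight m)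
    fun v => MvPolynomial.aeval (KP.jet v) (MvPolynomial.monomial m (1 : ℚ)) :=
  ⟨_, MvPolynomial.isWeightedHomogeneous_monomial _ m 1 rfl, fun _ _ => rfl⟩

lemma D_monomial (i : ℕ+) (m : Column →₀ ℕ)
    (h : ∀ c, m c ≠ 0 → IsJetPoly (colWeight c + i) fun v => D i (KP.jet v c)) :
    IsJetPoly (Finsupp.weight colWeight m + i)
      fun v => D i (MvPolynomial.aeval (KP.jet v) (MvPolynomial.monomial m (1 : ℚ))) := by
  induction m using Finsupp.induction_linear with
  | zero =>
    refine (zero _).congr fun v _ => ?_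
    change D i (MvPolynomial.aeval (KP.jet v) (1 : MvPolynomial Column ℚ)) = 0
    rw [map_one, Derivation.map_one_eq_zero]
  | add f g hf hg =>
    have hf := hf fun c hc => h c (by rw [Finsupp.add_apply]; omega)
    have hg := hg fun c hc => h c (by rw [Finsupp.add_apply]; omega)
    refine (((monomial f).mul hg).of_weight_eq ?_).add (((monomial g).mul hf).of_weight_eq ?_)
      |>.congr fun v _ => ?_
    · rw [map_add, add_assoc]
    · rw [map_add, add_left_comm, ← add_assoc]
    · have : MvPolynomial.monomial (f + g) (1 : ℚ) =
          MvPolynomial.monomial f 1 * MvPolynomial.monomial g 1 := by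
        rw [MvPolynomial.monomial_mul, mul_one]
      rw [this, map_mul, Derivation.leibniz, smul_eq_mul, smul_eq_mul]
  | single c n =>
    rcases Nat.eq_zero_or_pos n with rfl | hn
    · refine (zero _).congr fun v _ => ?_
      rw [Finsupp.single_zero]
      change D i (MvPolynomial.aeval (KP.jet v) (1 : MvPolynomial Column ℚ)) = 0
      rw [map_one, Derivation.map_one_eq_zero]
    · have hc := h c (by simp [hn.ne'])
      have h1 := ((monomial (Finsupp.single c (n - 1))).mul hc).natCast_mul n
      have hw : Finsupp.weight colWeight (Finsupp.single c (n - 1)) + (colWeight c + i) =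
          Finsupp.weight colWeight (Finsupp.single c n) + i := by
        obtain ⟨n, rfl⟩ := Nat.exists_eq_add_of_lt hn
        simp only [Finsupp.weight_single, smul_eq_mul, zero_add, Nat.add_sub_cancel]
        ring
      rw [hw] at h1
      refine h1.congr fun v _ => ?_
      rw [MvPolynomial.aeval_monomial, MvPolynomial.aeval_monomial, Finsupp.prod_single_index
        (by simp), Finsupp.prod_single_index (by simp), map_one, one_mul, one_mul,
        Derivation.leibniz_pow, nsmul_eq_mul, smul_eq_mul]

/-- Only columns of weight at most N occur in a polynomial of weight N. This bound on the hypothesis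
is what lets the induction on the weight close. -/
lemma D (i : ℕ+) (hF : IsJetPoly N F)
    (h : ∀ c, colWeight c ≤ N → IsJetPoly (colWeight c + i) fun v => KP.D i (KP.jet v c)) :
    IsJetPoly (N + i) fun v => KP.D i (F v) := by
  obtain ⟨P, hP, hF⟩ := hF
  have h1 : IsJetPoly (N + i) fun v => ∑ m ∈ P.support, P.coeff m •
      KP.D i (MvPolynomial.aeval (KP.jet v) (MvPolynomial.monomial m (1 : ℚ))) := by
    refine sum _ fun m hm => smul _ ?_
    have hw := hP (MvPolynomial.mem_support_iff.mp hm)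
    rw [← hw]
    refine D_monomial i m fun c hc => h c ?_
    rw [← hw]
    exact Finsupp.le_weight_of_ne_zero (fun _ => Nat.zero_le _) hc
  refine h1.congr fun v hv => ?_
  rw [hF v hv]
  conv_lhs => rw [P.as_sum, map_sum, map_sum]
  refine Finset.sum_congr rfl fun m _ => ?_
  have : MvPolynomial.monomial m (P.coeff m) = P.coeff m • MvPolynomial.monomial m (1 : ℚ) := by
    rw [MvPolynomial.smul_monomial, smul_eq_mul, mul_one]
  rw [this, map_smul]
  exact map_smul (dEnd i) _ _

lemma D_one (hF : IsJetPoly N F) : IsJetPoly (N + 1) fun v => KP.D 1 (F v) := by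
  refine hF.D 1 fun c _ => ?_
  refine (jet (c.1, c.2 + 1)).congr fun v _ => ?_
  rw [KP.jet, KP.jet, D_comm, PNat.add_coe, PNat.one_coe, Function.iterate_succ_apply']

end IsJetPoly

/-- The operator `∂_{i₁} ⋯ ∂_{iₙ}`. -/
def word (l : List ℕ+) : Module.End ℚ TimeSeries := (l.map dEnd).prod

lemma word_apply (l : List ℕ+) (v : TimeSeries) : word l v = iterD l v := by
  induction l with
  | nil => rfl
  | cons i l ih =>
    rw [word, List.map_cons, List.prod_cons]
    exact congrArg (D i) ih

/-- The span of the operators `∂_{i₁} ⋯ ∂_{iₙ}` with `n ≥ m` and `i₁ + ⋯ + iₙ = N`. -/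
def words (m N : ℕ) : Submodule ℚ (Module.End ℚ TimeSeries) :=
  Submodule.span ℚ
    {T | ∃ l : List ℕ+, m ≤ l.length ∧ (l.map fun i : ℕ+ => (i : ℕ)).sum = N ∧ T = word l}

lemma word_mem_words {m N : ℕ} (l : List ℕ+) (h : m ≤ l.length)
    (hN : (l.map fun i : ℕ+ => (i : ℕ)).sum = N) : word l ∈ words m N :=
  Submodule.subset_span ⟨l, h, hN, rfl⟩

lemma mul_mem_words {m n M N : ℕ} {S T : Module.End ℚ TimeSeries} (hS : S ∈ words m M)
    (hT : T ∈ words n N) : S * T ∈ words (m + n) (M + N) := by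
  have h := Submodule.mul_mem_mul hS hT
  rw [words, words, Submodule.span_mul_span] at h
  refine Submodule.span_mono ?_ h
  rintro _ ⟨_, ⟨l, hl, rfl, rfl⟩, _, ⟨l', hl', rfl, rfl⟩, rfl⟩
  exact ⟨l ++ l', by rw [List.length_append]; omega, by simp, by simp [word]⟩

lemma dEnd_mem_words (i : ℕ+) : dEnd i ∈ words 1 i := by
  have := word_mem_words (m := 1) (N := i) [i] (by simp) (by simp)
  simpa [word] using this

lemma sum_parts {r : ℕ} (c : Composition r) :
    ((parts c).map fun i : ℕ+ => (i : ℕ)).sum = r := by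
  rw [map_parts, c.blocks_sum]

/-- The one-block composition is the only one giving an operator of order 1, and its term is -∂_i/i.
-/
lemma shiftOp_add_mem_words (i : ℕ+) : shiftOp i + (1 / (i : ℚ)) • dEnd i ∈ words 2 i := by
  have h : shiftOp i = -∑ c : Composition (i : ℕ), ((-1 : ℚ) ^ (c.length + 1) /
      ((c.length.factorial : ℚ) * (c.blocks.prod : ℚ))) • word (parts c) := by
    ext1 v
    rw [← neg_eq_iff_eq_neg.mpr (eta_eq v i), eta, LinearMap.neg_apply, LinearMap.sum_apply]
    simp only [LinearMap.smul_apply, word_apply]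
  have hs : parts (Composition.single i i.pos) = [i] := by
    have h1 := map_parts (Composition.single i i.pos)
    rw [Composition.single_blocks] at h1
    exact List.map_injective_iff.mpr PNat.coe_injective (h1.trans (by simp))
  rw [h, ← Finset.add_sum_erase _ _ (Finset.mem_univ (Composition.single i i.pos)), hs,
    Composition.single_length, Composition.single_blocks]
  have e : ∀ A B : Module.End ℚ TimeSeries, -(A + B) + A = -B := fun A B => by abel
  have hw : word [i] = dEnd i := by simp [word]
  have hc : ((-1 : ℚ) ^ (1 + 1) / (((1 : ℕ).factorial : ℚ) * (([(i : ℕ)].prod : ℕ) : ℚ))) = 1 / i := by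
    simp
  rw [hw, hc, e]
  refine neg_mem (sum_mem fun c hc => Submodule.smul_mem _ _ (word_mem_words _ ?_ (sum_parts c)))
  have h1 := (Composition.ne_single_iff i.pos).mp (Finset.ne_of_mem_erase hc)
  have h2 : c.length ≠ 1 := fun h3 => Finset.ne_of_mem_erase hc
    ((Composition.eq_single_iff_length i.pos).mpr h3)
  have h3 := c.length_pos_iff.mpr i.pos
  rw [length_parts]
  omega

lemma words_anti {m n N : ℕ} (h : m ≤ n) : words n N ≤ words m N := by
  refine Submodule.span_mono ?_
  rintro _ ⟨l, hl, hN, rfl⟩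
  exact ⟨l, h.trans hl, hN, rfl⟩

lemma shiftOp_mem_words (i : ℕ+) : shiftOp i ∈ words 1 i := by
  have h := sub_mem (words_anti (Nat.le_succ 1) (shiftOp_add_mem_words i))
    (Submodule.smul_mem _ (1 / (i : ℚ)) (dEnd_mem_words i))
  rwa [add_sub_cancel_right] at h

lemma isJetPoly_of_mem_words {m N : ℕ}
    (h : ∀ l : List ℕ+, m ≤ l.length → (l.map fun i : ℕ+ => (i : ℕ)).sum = N →
      IsJetPoly N (iterD l)) {T : Module.End ℚ TimeSeries} (hT : T ∈ words m N) :
    IsJetPoly N T := by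
  induction hT using Submodule.span_induction with
  | mem x hx =>
    obtain ⟨l, hl, hN, rfl⟩ := hx
    exact (h l hl hN).congr fun v _ => word_apply l v
  | zero => exact IsJetPoly.zero N
  | add x y _ _ hx hy => exact hx.add hy
  | smul q x _ hx => exact hx.smul q

/-- A column contains at least one ∂. Moving it outermost leaves a word of weight one less, still of
length at least 2, to which the induction hypothesis applies; ∂ maps jets to jets. -/
lemma isJetPoly_D_jet {N : ℕ} (i : ℕ+) (c : Column)
    (ih : ∀ l : List ℕ+, 2 ≤ l.length → (l.map fun i : ℕ+ => (i : ℕ)).sum < N →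
      IsJetPoly (l.map fun i : ℕ+ => (i : ℕ)).sum (iterD l))
    (hc : colWeight c + i ≤ N) : IsJetPoly (colWeight c + i) fun v => D i (jet v c) := by
  obtain ⟨t, ht⟩ : ∃ t : ℕ, (c.2 : ℕ) = t + 1 := ⟨c.2.natPred, c.2.natPred_add_one.symm⟩
  have hsum : ((i :: c.1 :: List.replicate t 1).map fun i : ℕ+ => (i : ℕ)).sum = i + (c.1 + t) := by
    simp
  have hcw : colWeight c = c.1 + c.2 := rfl
  have h := ih (i :: c.1 :: List.replicate t 1) (by simp) (by rw [hsum]; omega)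
  rw [hsum] at h
  refine (h.D_one.of_weight_eq (by omega)).congr fun v _ => ?_
  have hrep : ∀ t : ℕ, iterD (List.replicate t 1) v = (D 1)^[t] v := by
    intro t
    induction t with
    | zero => rfl
    | succ t ih => rw [Function.iterate_succ_apply', ← ih]; rfl
  rw [jet, ht, Function.iterate_succ_apply', ← hrep, D_comm c.1, D_comm i]
  rfl

/-- Without its first letter the word still has length at least 2 and has smaller weight, so it is
already a polynomial in jets, and the chain rule handles the removed letter. -/
lemma isJetPoly_of_three_le {N : ℕ}
    (ih : ∀ l : List ℕ+, 2 ≤ l.length → (l.map fun i : ℕ+ => (i : ℕ)).sum < N →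
      IsJetPoly (l.map fun i : ℕ+ => (i : ℕ)).sum (iterD l))
    (l : List ℕ+) (hl : 3 ≤ l.length) (hN : (l.map fun i : ℕ+ => (i : ℕ)).sum = N) :
    IsJetPoly N (iterD l) := by
  cases l with
  | nil => simp at hl
  | cons i l =>
    simp only [List.length_cons, List.map_cons, List.sum_cons] at hl hN
    have hi := i.pos
    refine ((ih l (by omega) (by omega)).D i fun c hc => ?_).of_weight_eq (by omega)
    exact isJetPoly_D_jet i c ih (by omega)

/-- Arranged so that each product on the right contains S + xa or T + yb. For S = S_i and T = S_j
these factors have order at least 2, so each product has order at least 3. -/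
lemma mul_smul_mul_sub (x y : ℚ) (S T a b : Module.End ℚ TimeSeries) :
    (x * y) • (a * b) - S * T =
      (S + x • a) * (y • b) + (x • a) * (T + y • b) - (S + x • a) * (T + y • b) := by
  ext1 v
  simp only [LinearMap.sub_apply, LinearMap.add_apply, LinearMap.smul_apply, Module.End.mul_apply,
    map_add, map_smul, mul_smul, smul_add, smul_comm y x]
  abel

lemma isJetPoly_D_D {N : ℕ}
    (ih : ∀ l : List ℕ+, 2 ≤ l.length → (l.map fun i : ℕ+ => (i : ℕ)).sum < N →
      IsJetPoly (l.map fun i : ℕ+ => (i : ℕ)).sum (iterD l))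
    (i j : ℕ+) (hN : (i + j : ℕ) = N) : IsJetPoly N fun v => D i (D j v) := by
  have hw : ∀ {M : ℕ} {T : Module.End ℚ TimeSeries}, M < N → T ∈ words 2 M → IsJetPoly M T :=
    fun hM hT => isJetPoly_of_mem_words (fun l hl hlM => hlM ▸ ih l hl (hlM ▸ hM)) hT
  -- The part -∂_r/r of S_r gives the column (r, 1); the rest has weight r < N and falls under the
  -- induction hypothesis before ∂ is applied.
  have heta : ∀ r : ℕ, r ≠ 0 → r < N → IsJetPoly (r + 1) fun v => D 1 (eta v r) := by
    intro r hr hrN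
    obtain ⟨r, rfl⟩ : ∃ s : ℕ+, r = s := ⟨⟨r, Nat.pos_of_ne_zero hr⟩, rfl⟩
    have h1 := (hw hrN (shiftOp_add_mem_words r)).D_one.neg.add
      (((IsJetPoly.jet (r, 1)).smul (1 / (r : ℚ))).of_weight_eq (by simp [colWeight]))
    refine h1.congr fun v _ => ?_
    have e : D 1 (eta v r) = -D 1 ((shiftOp r + (1 / (r : ℚ)) • dEnd r) v) +
        D 1 ((1 / (r : ℚ)) • D r v) := by
      rw [eta_eq, LinearMap.add_apply, map_add, map_neg]
      change _ = -(_ + D 1 ((1 / (r : ℚ)) • D r v)) + _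
      abel
    have e2 : D 1 ((1 / (r : ℚ)) • D r v) = (1 / (r : ℚ)) • jet v (r, 1) := by
      rw [jet, PNat.one_coe, Function.iterate_one, D_comm r]
      exact map_smul (dEnd 1) _ _
    rw [e, e2]
  have hSS : IsJetPoly N fun v => shiftOp i (shiftOp j v) := by
    obtain ⟨a, ha⟩ : ∃ a : ℕ, (i : ℕ) = a + 1 := ⟨i.natPred, i.natPred_add_one.symm⟩
    have hj := j.pos
    refine IsJetPoly.of_natCast_mul j.ne_zero ?_
    have h1 := ((heta (a + j) (by omega) (by omega)).of_weight_eq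
      (show a + j + 1 = N by omega)).natCast_mul j
    have h2 : IsJetPoly N fun v => ∑ p ∈ (antidiagonal a).erase (a, 0), ∑ q ∈ antidiagonal (j : ℕ),
        (q.1 : TimeSeries) * shiftOp (p.1 + 1) (eta v q.1) * shiftRatio v p.2 q.2 := by
      refine IsJetPoly.sum _ fun p hp => IsJetPoly.sum _ fun q hq => ?_
      obtain ⟨hp0, hp⟩ := Finset.mem_erase.mp hp
      have hp := mem_antidiagonal.mp hp
      have hq := mem_antidiagonal.mp hq
      have hp2 : p.2 ≠ 0 := fun h => hp0 (Prod.ext (by omega) h)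
      by_cases hq2 : q.2 = 0
      · refine (IsJetPoly.zero N).congr fun v _ => ?_
        simp [shiftRatio, hp2, hq2]
      by_cases hq1 : q.1 = 0
      · refine (IsJetPoly.zero N).congr fun v _ => ?_
        simp [hq1]
      have h3 := (heta (p.2 + q.2 - 1) (by omega) (by omega)).neg
      have h4 : IsJetPoly (p.1 + 1 + q.1) fun v => shiftOp (p.1 + 1) (eta v q.1) := by
        have hm := mul_mem_words (shiftOp_mem_words ⟨p.1 + 1, Nat.succ_pos _⟩)
          (shiftOp_mem_words ⟨q.1, Nat.pos_of_ne_zero hq1⟩)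
        refine (hw (M := p.1 + 1 + q.1) (by omega) hm).neg.congr fun v _ => ?_
        rw [eta_eq, map_neg]
        rfl
      refine (((h4.natCast_mul q.1).mul h3).of_weight_eq (by omega)).congr fun v _ => ?_
      rw [shiftRatio, if_neg hp2, if_neg hq2]
    refine (h1.add h2).congr fun v hv => ?_
    rw [ha]
    exact natCast_mul_shiftOp_shiftOp hv.shiftEquations a j.ne_zero
  have hi0 : (i : ℚ) ≠ 0 := by exact_mod_cast i.ne_zero
  have hj0 : (j : ℚ) ≠ 0 := by exact_mod_cast j.ne_zero
  have hA := shiftOp_add_mem_words i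
  have hB := shiftOp_add_mem_words j
  have hA' := Submodule.smul_mem _ (1 / (i : ℚ)) (dEnd_mem_words i)
  have hB' := Submodule.smul_mem _ (1 / (j : ℚ)) (dEnd_mem_words j)
  have hT : (1 / (i : ℚ) * (1 / (j : ℚ))) • (dEnd i * dEnd j) - shiftOp i * shiftOp j ∈
      words 3 N := by
    have h1 := mul_mem_words hA hB'
    have h2 := mul_mem_words hA' hB
    have h3 := words_anti (show 3 ≤ 2 + 2 by norm_num) (mul_mem_words hA hB)
    rw [hN] at h1 h2 h3
    have h4 := sub_mem (add_mem h1 h2) h3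
    rwa [← mul_smul_mul_sub] at h4
  have hT' := isJetPoly_of_mem_words (isJetPoly_of_three_le ih) hT
  refine ((hSS.add hT').smul (i * j : ℚ)).congr fun v _ => ?_
  change _ = (i * j : ℚ) • (shiftOp i (shiftOp j v) +
    ((1 / (i : ℚ) * (1 / (j : ℚ))) • D i (D j v) - shiftOp i (shiftOp j v)))
  rw [add_sub_cancel, smul_smul,
    show (i * j : ℚ) * (1 / (i : ℚ) * (1 / (j : ℚ))) = 1 by field_simp, one_smul]

lemma isJetPoly_iterD (l : List ℕ+) (hl : 2 ≤ l.length) :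
    IsJetPoly (l.map fun i : ℕ+ => (i : ℕ)).sum (iterD l) := by
  induction hN : (l.map fun i : ℕ+ => (i : ℕ)).sum using Nat.strong_induction_on generalizing l with
  | _ N ih =>
    have ih' : ∀ l : List ℕ+, 2 ≤ l.length → (l.map fun i : ℕ+ => (i : ℕ)).sum < N →
        IsJetPoly (l.map fun i : ℕ+ => (i : ℕ)).sum (iterD l) := fun l hl h => ih _ h l hl rfl
    rcases hl.eq_or_lt with h | h
    · obtain ⟨i, j, rfl⟩ := List.length_eq_two.mp h.symm
      exact isJetPoly_D_D ih' i j (by simpa using hN)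
    · exact isJetPoly_of_three_le ih' l h hN

/-- There is a system of universal coefficients of the KP hierarchy. -/
theorem exists_isUniversal : ∃ R, IsUniversal R := by
  have h : ∀ i j : ℕ+, IsJetPoly (i + j : ℕ) fun v => D i (D j v) := fun i j =>
    (isJetPoly_iterD [i, j] (by simp)).of_weight_eq (by simp)
  choose R hR using h
  exact ⟨R, hR⟩

end Universality

/-! ### Tau functions given by determinants with rank-one shifts -/

section TauFunctions

lemma shiftOp_smul (r : ℕ) (c : ℂ) (f : TimeSeries) : shiftOp r (c • f) = c • shiftOp r f := by
  refine eq_of_recursion (F := fun r => shiftOp r (c • f)) (G := fun r => c • shiftOp r f)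
    (by simp [shiftOp_zero]) (fun r => natCast_mul_shiftOp r _) (fun r => ?_) r
  rw [mul_smul_comm, natCast_mul_shiftOp, smul_neg, Finset.smul_sum]
  simp only [Derivation.map_smul]

/-- The Miwa shift as a ring homomorphism. -/
def miwa : TimeSeries →+* PowerSeries TimeSeries where
  toFun f := PowerSeries.mk fun r => shiftOp r f
  map_one' := by
    ext1 r
    rw [PowerSeries.coeff_mk, PowerSeries.coeff_one]
    split_ifs with h
    · rw [h, shiftOp_zero]
    · exact shiftOp_apply_one h
  map_zero' := by ext1 r; simp
  map_mul' f g := by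
    ext1 r
    simp only [PowerSeries.coeff_mk, PowerSeries.coeff_mul, shiftOp_mul]
  map_add' f g := by ext1 r; simp

lemma coeff_miwa (r : ℕ) (f : TimeSeries) : PowerSeries.coeff r (miwa f) = shiftOp r f := by
  change PowerSeries.coeff r (PowerSeries.mk fun r => shiftOp r f) = _
  rw [PowerSeries.coeff_mk]

/-- If `v = -log τ` then `τ(x - [k⁻¹]) = τ w`. -/
lemma shiftOp_tau {v τ : TimeSeries} (h : ∀ i, τ * D i v = -D i τ) (b : ℕ) :
    shiftOp b τ = xi v b * τ := by
  have hd : ∀ i : ℕ, dNat i τ = -(τ * dNat i v) := by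
    intro i
    rcases Nat.eq_zero_or_pos i with rfl | hi
    · simp
    · obtain ⟨i, rfl⟩ : ∃ j : ℕ+, i = j := ⟨⟨i, hi⟩, rfl⟩
      rw [dNat_coe, h, neg_neg]
  induction b using Nat.strong_induction_on with
  | _ b ih =>
    rcases Nat.eq_zero_or_pos b with rfl | hb
    · rw [shiftOp_zero, xi_zero, one_mul]
    · apply natCast_mul_cancel hb.ne'
      have e1 : (b : TimeSeries) * shiftOp b τ =
          ∑ p ∈ antidiagonal b, ∑ q ∈ antidiagonal p.2,
            shiftOp q.1 τ * dNat p.1 (shiftOp q.2 v) := by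
        rw [natCast_mul_shiftOp, ← Finset.sum_neg_distrib]
        refine Finset.sum_congr rfl fun p _ => ?_
        rw [← shiftOp_dNat, hd, map_neg, neg_neg, shiftOp_mul]
        simp only [shiftOp_dNat]
      rw [e1, sum_antidiagonal_left_comm b fun a c d => shiftOp c τ * dNat a (shiftOp d v),
        ← mul_assoc, natCast_mul_xi, Finset.sum_mul, ← Finset.Nat.sum_antidiagonal_swap]
      refine Finset.sum_congr rfl fun p hp => ?_
      have hp := mem_antidiagonal.mp hp
      rw [Prod.fst_swap, Prod.snd_swap, ← Finset.mul_sum, ← neg_neg (∑ q ∈ antidiagonal p.1, _),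
        ← natCast_mul_shiftOp]
      rcases Nat.eq_zero_or_pos p.1 with h0 | h0
      · simp [h0]
      · rw [ih p.2 (by omega), eta_eq]
        ring

variable {ι : Type*} [Fintype ι] [DecidableEq ι]

/-- A determinant whose Miwa shifts are perturbations of rank one gives a formal solution. -/
theorem isSolution_of_rank_one (Θ : Matrix ι ι TimeSeries) (u w : ι → TimeSeries) (q : ι → ℂ)
    (hu : ∀ m, m ≠ 0 → ∀ i, shiftOp (m + 1) (u i) = 0)
    (hw : ∀ m j, shiftOp m (w j) = q j ^ m • w j)
    (hΘ : ∀ m i j, shiftOp (m + 1) (Θ i j) = -(u i * q j ^ m • w j))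
    (hτ : IsUnit Θ.det) {v : TimeSeries} (hv : ∀ i, Θ.det * D i v = -D i Θ.det) :
    IsSolution v := by
  obtain ⟨φ, hφ⟩ : ∃ φ, Θ.mulVec φ = u :=
    ⟨Θ⁻¹.mulVec u, by rw [Matrix.mulVec_mulVec, Matrix.mul_nonsing_inv _ hτ, Matrix.one_mulVec]⟩
  have hinj : ∀ x y, Θ.mulVec x = Θ.mulVec y → x = y := by
    intro x y hxy
    have := congrArg Θ⁻¹.mulVec hxy
    rwa [Matrix.mulVec_mulVec, Matrix.mulVec_mulVec, Matrix.nonsing_inv_mul _ hτ,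
      Matrix.one_mulVec, Matrix.one_mulVec] at this
  -- Here T_y Θ = Θ (1 + φ r) with r_j = -y w_j / (1 - q_j y), so the matrix determinant lemma gives
  -- T_y τ / τ = 1 + r φ.
  have hxi : ∀ b, xi v (b + 1) = -∑ j, q j ^ b • (w j * φ j) := by
    intro b
    set r : ι → PowerSeries TimeSeries := fun j =>
      -(PowerSeries.X * PowerSeries.mk fun b => q j ^ b • w j) with hr
    have h1 : Θ.map miwa = Θ.map (PowerSeries.C (R := TimeSeries)) *
        (1 + Matrix.replicateCol Unit (fun i => PowerSeries.C (φ i)) *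
          Matrix.replicateRow Unit r) := by
      have h2 : Θ.map (PowerSeries.C (R := TimeSeries)) *
          Matrix.replicateCol Unit (fun i => PowerSeries.C (φ i)) =
          Matrix.replicateCol Unit (fun i => PowerSeries.C (u i)) := by
        ext1 i j
        rw [← hφ]
        simp [Matrix.mul_apply, Matrix.mulVec, dotProduct]
      rw [Matrix.mul_add, Matrix.mul_one, ← Matrix.mul_assoc, h2]
      ext1 i j
      simp only [Matrix.map_apply, Matrix.add_apply, Matrix.mul_apply, Matrix.replicateCol_apply,
        Matrix.replicateRow_apply, Finset.univ_unique, Finset.sum_singleton]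
      ext1 m
      rw [coeff_miwa, map_add, hr, mul_neg, map_neg, PowerSeries.coeff_C_mul]
      cases m with
      | zero => simp [shiftOp_zero]
      | succ m => simp [PowerSeries.coeff_succ_X_mul, hΘ]
    have h3 := congrArg Matrix.det h1
    rw [Matrix.det_mul, Matrix.det_one_add_replicateCol_mul_replicateRow] at h3
    have h4 : (Θ.map miwa).det = miwa Θ.det := (RingHom.map_det miwa Θ).symm
    have h5 : (Θ.map (PowerSeries.C (R := TimeSeries))).det = PowerSeries.C Θ.det :=
      (RingHom.map_det (PowerSeries.C (R := TimeSeries)) Θ).symm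
    rw [h4, h5] at h3
    have h6 := congrArg (PowerSeries.coeff (b + 1)) h3
    rw [coeff_miwa, shiftOp_tau hv, PowerSeries.coeff_C_mul, map_add, PowerSeries.coeff_one,
      if_neg (Nat.succ_ne_zero b), zero_add, mul_comm] at h6
    rw [hτ.mul_left_cancel h6, dotProduct, map_sum, ← Finset.sum_neg_distrib]
    refine Finset.sum_congr rfl fun j _ => ?_
    rw [hr, neg_mul, map_neg, mul_assoc, PowerSeries.coeff_succ_X_mul, PowerSeries.coeff_mul_C,
      PowerSeries.coeff_mk, smul_mul_assoc]
  have h1 : ∑ j, w j * φ j = -D 1 v := by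
    have := hxi 0
    rw [xi_one] at this
    simp only [pow_zero, one_smul] at this
    rw [this, neg_neg]
  have hS1 : ∀ m, shiftOp m (D 1 v) = -D 1 (eta v m) := by
    intro m
    rw [shiftOp_D, eta_eq, map_neg, neg_neg]
  -- Shift Θ φ = u. In order m + 1 ≥ 2 the right side vanishes and the rank-one term is u times
  -- S_m(∑ w_j φ_j) = -S_m(∂v) = ∂η_m; then Θ can be cancelled.
  have hφS : ∀ m, m ≠ 0 → ∀ j, shiftOp (m + 1) (φ j) = φ j * D 1 (eta v m) := by
    intro m hm
    rw [← funext_iff (f := fun j => shiftOp (m + 1) (φ j)) (g := fun j => φ j * D 1 (eta v m))]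
    apply hinj
    funext i
    have h2 := hu m hm i
    rw [← hφ, Matrix.mulVec, dotProduct, map_sum] at h2
    have h3 : ∀ j, shiftOp (m + 1) (Θ i j * φ j) = Θ i j * shiftOp (m + 1) (φ j) -
        u i * shiftOp m (w j * φ j) := by
      intro j
      rw [shiftOp_mul, Finset.Nat.sum_antidiagonal_succ, shiftOp_zero, shiftOp_mul, Finset.mul_sum,
        sub_eq_add_neg, ← Finset.sum_neg_distrib]
      congr 1
      refine Finset.sum_congr rfl fun p _ => ?_
      rw [hΘ, hw]
      ring
    simp only [h3, Finset.sum_sub_distrib] at h2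
    rw [← Finset.mul_sum, ← map_sum, h1, map_neg, hS1, neg_neg, sub_eq_zero] at h2
    have h4 : u i = ∑ j, Θ i j * φ j := by rw [← hφ]; rfl
    rw [Matrix.mulVec, dotProduct, h2, h4, Finset.sum_mul]
    simp only [Matrix.mulVec, dotProduct, mul_assoc]
  apply ShiftEquations.isSolution
  intro m hm b
  cases b with
  | zero =>
    rw [xi_zero, shiftOp_apply_one (Nat.succ_ne_zero m), xi_one, hS1]
    ring
  | succ b =>
    have h2 : ∀ m b j, shiftOp m (q j ^ b • (w j * φ j)) =
        ∑ p ∈ antidiagonal m, q j ^ (p.1 + b) • (w j * shiftOp p.2 (φ j)) := by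
      intro m b j
      rw [shiftOp_smul, shiftOp_mul, Finset.smul_sum]
      refine Finset.sum_congr rfl fun p _ => ?_
      rw [hw, smul_mul_assoc, smul_smul, pow_add, mul_comm]
    rw [hxi, hxi, map_neg, map_neg, map_sum, map_sum, neg_sub_neg, ← Finset.sum_sub_distrib,
      mul_neg, Finset.mul_sum, ← Finset.sum_neg_distrib]
    refine Finset.sum_congr rfl fun j _ => ?_
    rw [h2, h2, Finset.Nat.sum_antidiagonal_succ, hφS m hm]
    simp only [add_assoc, add_comm 1 b, zero_add]
    rw [sub_add_cancel_right, mul_smul_comm, mul_comm (D 1 _), mul_assoc]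

end TauFunctions

/-! ### Soliton solutions and their behaviour under x ↦ -x -/

section Solitons

lemma coeff_D (i : ℕ+) (f : TimeSeries) (m : ℕ+ →₀ ℕ) :
    MvPowerSeries.coeff m (D i f) =
      MvPowerSeries.coeff (m + Finsupp.single i 1) f * ((m i : ℂ) + 1) :=
  MvPowerSeries.coeff_pderiv f m

/-- The exponential `exp (∑ a_j x_j)`. -/
def expSeries (a : ℕ+ → ℂ) : TimeSeries :=
  fun m => m.prod fun j n => a j ^ n / (n.factorial : ℂ)

lemma coeff_expSeries (a : ℕ+ → ℂ) (m : ℕ+ →₀ ℕ) :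
    MvPowerSeries.coeff m (expSeries a) = m.prod fun j n => a j ^ n / (n.factorial : ℂ) := rfl

lemma constantCoeff_expSeries (a : ℕ+ → ℂ) : MvPowerSeries.constantCoeff (expSeries a) = 1 := by
  rw [← MvPowerSeries.coeff_zero_eq_constantCoeff_apply, coeff_expSeries, Finsupp.prod_zero_index]

lemma D_expSeries (a : ℕ+ → ℂ) (i : ℕ+) : D i (expSeries a) = a i • expSeries a := by
  ext m
  rw [coeff_D, MvPowerSeries.coeff_smul, coeff_expSeries, coeff_expSeries]
  have hg : ∀ j : ℕ+, a j ^ 0 / ((0 : ℕ).factorial : ℂ) = 1 := by simp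
  rw [← Finsupp.mul_prod_erase' (m + Finsupp.single i 1) i _ hg,
    ← Finsupp.mul_prod_erase' m i _ hg, Finsupp.erase_add, Finsupp.erase_single, add_zero,
    Finsupp.add_apply, Finsupp.single_eq_same, Nat.factorial_succ, pow_succ]
  have h1 : (m i : ℂ) + 1 ≠ 0 := by exact_mod_cast Nat.succ_ne_zero (m i)
  have h2 : ((m i).factorial : ℂ) ≠ 0 := by exact_mod_cast (m i).factorial_ne_zero
  push_cast
  field_simp

/-- The exponential `exp (∑ p^j x_j)`. -/
def expPos (p : ℂ) : TimeSeries := expSeries fun j => p ^ (j : ℕ)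

/-- The exponential `exp (-∑ q^j x_j)`. -/
def expNeg (q : ℂ) : TimeSeries := expSeries fun j => -q ^ (j : ℕ)

lemma dNat_expPos (p : ℂ) {j : ℕ} (hj : j ≠ 0) : dNat j (expPos p) = p ^ j • expPos p := by
  obtain ⟨j, rfl⟩ : ∃ i : ℕ+, j = i := ⟨⟨j, Nat.pos_of_ne_zero hj⟩, rfl⟩
  rw [dNat_coe]
  exact D_expSeries _ _

lemma dNat_expNeg (q : ℂ) {j : ℕ} (hj : j ≠ 0) : dNat j (expNeg q) = (-q ^ j) • expNeg q := by
  obtain ⟨j, rfl⟩ : ∃ i : ℕ+, j = i := ⟨⟨j, Nat.pos_of_ne_zero hj⟩, rfl⟩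
  rw [dNat_coe]
  exact D_expSeries _ _

/-- The shift multiplies by exp(-∑ (py)^j/j) = 1 - py, which is linear in y. -/
lemma shiftOp_expPos (p : ℂ) {m : ℕ} (hm : m ≠ 0) : shiftOp (m + 1) (expPos p) = 0 := by
  let σ : ℕ → ℂ := fun r => if r = 0 then 1 else if r = 1 then -p else 0
  have h := eq_of_recursion (F := fun r => shiftOp r (expPos p)) (G := fun r => σ r • expPos p)
    (by simp [shiftOp_zero, σ]) (fun r => natCast_mul_shiftOp r _) (fun r => ?_) (m + 1)
  · simpa [σ, hm] using h
  · match r with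
    | 0 => simp
    | 1 =>
      rw [Finset.Nat.sum_antidiagonal_succ]
      simp [σ, dNat_expPos]
    | r + 2 =>
      rw [Finset.Nat.sum_antidiagonal_succ', Finset.Nat.sum_antidiagonal_succ']
      simp only [Derivation.map_smul, dNat_expPos p (Nat.succ_ne_zero _), σ, smul_smul]
      simp [pow_succ']

lemma shiftOp_expNeg (q : ℂ) (m : ℕ) : shiftOp m (expNeg q) = q ^ m • expNeg q := by
  refine eq_of_recursion (F := fun r => shiftOp r (expNeg q)) (G := fun r => q ^ r • expNeg q)
    (by simp [shiftOp_zero]) (fun r => natCast_mul_shiftOp r _) (fun r => ?_) m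
  cases r with
  | zero => simp
  | succ r =>
    rw [Finset.Nat.sum_antidiagonal_succ, dNat_zero, Derivation.zero_apply, zero_add]
    have : ∀ p ∈ antidiagonal r, dNat (p.1 + 1) (q ^ p.2 • expNeg q) =
        -(q ^ (r + 1) • expNeg q) := by
      intro p hp
      rw [Derivation.map_smul, dNat_expNeg q (Nat.succ_ne_zero _), smul_smul, ← neg_smul,
        ← mem_antidiagonal.mp hp]
      congr 1
      rw [Nat.succ_eq_add_one]
      ring
    rw [Finset.sum_congr rfl this, Finset.sum_const, Finset.Nat.card_antidiagonal, smul_neg,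
      neg_neg, nsmul_eq_mul]

lemma shiftOp_one_expPos (p : ℂ) : shiftOp 1 (expPos p) = (-p) • expPos p := by
  have := dNat_expPos p one_ne_zero
  rw [shiftOp_one, ← dNat_coe, PNat.one_coe, this, pow_one, neg_smul]

/-- Expansion of (1 - py)/(1 - qy) = 1 - ∑ (p - q) q^m y^(m+1). -/
lemma shiftOp_expPos_mul_expNeg (p q : ℂ) (m : ℕ) :
    shiftOp (m + 1) (expPos p * expNeg q) =
      (-((p - q) * q ^ m)) • (expPos p * expNeg q) := by
  have h : ∀ m, shiftOp (m + 1) (expPos p * expNeg q) =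
      expPos p * shiftOp (m + 1) (expNeg q) + shiftOp 1 (expPos p) * shiftOp m (expNeg q) := by
    intro m
    rw [shiftOp_mul, Finset.Nat.sum_antidiagonal_succ, shiftOp_zero]
    congr 1
    cases m with
    | zero => simp
    | succ m =>
      rw [Finset.Nat.sum_antidiagonal_succ, Finset.sum_eq_zero, add_zero]
      intro x _
      rw [shiftOp_expPos p (Nat.succ_ne_zero _), zero_mul]
  rw [h, shiftOp_one_expPos, shiftOp_expNeg, shiftOp_expNeg, mul_smul_comm, smul_mul_assoc,
    mul_smul_comm, smul_smul, ← add_smul]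
  congr 1
  ring

/-- A curl-free family of power series has a potential. -/
lemma exists_potential (g : ℕ+ → TimeSeries) (hg : ∀ i j, D i (g j) = D j (g i)) :
    ∃ v : TimeSeries, MvPowerSeries.constantCoeff v = 0 ∧ ∀ i, D i v = g i := by
  -- Euler's identity: the coefficients of a potential satisfy |m| v_m = ∑ m_i v_m, where m_i v_m is
  -- the coefficient of g_i at m - e_i. At m = 0 division by zero gives the value 0.
  let v : TimeSeries := fun m => (∑ i ∈ m.support,
    MvPowerSeries.coeff (m - Finsupp.single i 1) (g i)) / (m.degree : ℂ)
  have hv : ∀ m, MvPowerSeries.coeff m v = (∑ i ∈ m.support,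
    MvPowerSeries.coeff (m - Finsupp.single i 1) (g i)) / (m.degree : ℂ) := fun m => rfl
  refine ⟨v, ?_, fun j => ?_⟩
  · rw [← MvPowerSeries.coeff_zero_eq_constantCoeff_apply, hv]
    simp
  · ext m
    rw [coeff_D, hv]
    set M := m + Finsupp.single j 1 with hM
    have hdeg : (M.degree : ℂ) ≠ 0 := by
      rw [hM, map_add, Finsupp.degree_single]
      exact_mod_cast Nat.succ_ne_zero m.degree
    have key : ∀ i ∈ M.support, MvPowerSeries.coeff (M - Finsupp.single i 1) (g i) *
        ((m j : ℂ) + 1) = (M i : ℂ) * MvPowerSeries.coeff m (g j) := by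
      intro i hi
      by_cases hij : i = j
      · subst hij
        rw [hM, add_tsub_cancel_right, Finsupp.add_apply, Finsupp.single_eq_same]
        push_cast
        ring
      · have hi' : M i = m i := by
          rw [hM, Finsupp.add_apply, Finsupp.single_eq_of_ne hij, add_zero]
        have hmi : m i ≠ 0 := by rw [← hi']; exact Finsupp.mem_support_iff.mp hi
        have hle : Finsupp.single i 1 ≤ m := by
          rw [Finsupp.single_le_iff]; omega
        have h1 := congrArg (MvPowerSeries.coeff (m - Finsupp.single i 1)) (hg i j)
        have h2 : m - Finsupp.single i 1 + Finsupp.single i 1 = m := tsub_add_cancel_of_le hle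
        have h3 : m - Finsupp.single i 1 + Finsupp.single j 1 = M - Finsupp.single i 1 := by
          rw [hM, tsub_add_eq_add_tsub hle]
        have h4 : (m - Finsupp.single i 1 : ℕ+ →₀ ℕ) j = m j := by
          rw [Finsupp.tsub_apply, Finsupp.single_eq_of_ne (Ne.symm hij), Nat.sub_zero]
        have h5 : (((m - Finsupp.single i 1 : ℕ+ →₀ ℕ) i : ℕ) : ℂ) + 1 = m i := by
          rw [Finsupp.tsub_apply, Finsupp.single_eq_same]
          exact_mod_cast Nat.sub_add_cancel (Nat.one_le_iff_ne_zero.mpr hmi)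
        rw [coeff_D, coeff_D, h2, h3, h4, h5] at h1
        rw [← h1, hi', mul_comm]
    rw [div_mul_eq_mul_div, Finset.sum_mul, Finset.sum_congr rfl key, ← Finset.sum_mul,
      div_eq_iff hdeg, Finsupp.degree_apply, mul_comm]
    push_cast
    rfl

lemma exists_log (τ : TimeSeries) (h : MvPowerSeries.constantCoeff τ ≠ 0) :
    ∃ v : TimeSeries, MvPowerSeries.constantCoeff v = 0 ∧ ∀ i, τ * D i v = -D i τ := by
  obtain ⟨v, hv0, hv⟩ := exists_potential (fun i => -(τ⁻¹ * D i τ)) (fun i j => by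
    have h1 : ∀ i, D i τ⁻¹ = -τ⁻¹ ^ 2 * D i τ := fun i => MvPowerSeries.pderiv_inv' τ
    rw [map_neg, map_neg, Derivation.leibniz, Derivation.leibniz, D_comm i j, h1, h1]
    simp only [smul_eq_mul]
    ring)
  refine ⟨v, hv0, fun i => ?_⟩
  rw [hv, mul_neg, ← mul_assoc, MvPowerSeries.mul_inv_cancel _ h, one_mul]

variable {ι : Type*}

/-- The matrix `a_i b_j (exp (∑ (p_i^k - q_j^k) x_k) - 1) / (p_i - q_j)`. -/
def solitonMatrix (p q a b : ι → ℂ) : Matrix ι ι TimeSeries :=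
  fun i j => (a i * b j / (p i - q j)) • (expPos (p i) * expNeg (q j) - 1)

lemma constantCoeff_solitonMatrix (p q a b : ι → ℂ) :
    (solitonMatrix p q a b).map (MvPowerSeries.constantCoeff (R := ℂ)) = 0 := by
  ext i j
  rw [Matrix.map_apply, solitonMatrix, MvPowerSeries.smul_eq_C_mul, map_mul, map_sub, map_mul,
    expPos, expNeg, constantCoeff_expSeries, constantCoeff_expSeries]
  simp

variable [Fintype ι] [DecidableEq ι]

/-- The tau function of a soliton solution, normalized by `τ(0) = 1`. -/
def solitonTau (p q a b : ι → ℂ) : TimeSeries := (1 + solitonMatrix p q a b).det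

lemma constantCoeff_solitonTau (p q a b : ι → ℂ) :
    MvPowerSeries.constantCoeff (solitonTau p q a b) = 1 := by
  rw [solitonTau, RingHom.map_det, RingHom.mapMatrix_apply, Matrix.map_add _ (map_add _),
    constantCoeff_solitonMatrix, add_zero, Matrix.map_one _ (map_zero _) (map_one _),
    Matrix.det_one]

/-- The denominators p_i - q_j cancel the factor produced by shifting the exponentials, so the
shifted entries factor into a part depending on i and a part depending on j. The subtracted
constants are invisible to positive orders of the shift. -/
theorem isSolution_soliton (p q a b : ι → ℂ) (hpq : ∀ i j, p i ≠ q j) {v : TimeSeries}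
    (hv : ∀ i, solitonTau p q a b * D i v = -D i (solitonTau p q a b)) : IsSolution v := by
  refine isSolution_of_rank_one (1 + solitonMatrix p q a b) (fun i => a i • expPos (p i))
    (fun j => b j • expNeg (q j)) q ?_ ?_ ?_ ?_ hv
  · intro m hm i
    rw [shiftOp_smul, shiftOp_expPos _ hm, smul_zero]
  · intro m j
    rw [shiftOp_smul, shiftOp_expNeg, smul_comm]
  · intro m i j
    have h1 : shiftOp (m + 1) ((1 : Matrix ι ι TimeSeries) i j) = 0 := by
      rw [Matrix.one_apply]
      split_ifs
      · exact shiftOp_apply_one (Nat.succ_ne_zero m)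
      · rw [map_zero]
    have h2 : p i - q j ≠ 0 := sub_ne_zero.mpr (hpq i j)
    rw [Matrix.add_apply, map_add, h1, zero_add, solitonMatrix, shiftOp_smul, map_sub,
      shiftOp_apply_one (Nat.succ_ne_zero m), sub_zero, shiftOp_expPos_mul_expNeg, smul_smul,
      smul_smul, smul_mul_smul_comm, ← neg_smul]
    congr 1
    field_simp
  · have h := constantCoeff_solitonTau p q a b
    rw [solitonTau] at h
    rw [MvPowerSeries.isUnit_iff_constantCoeff, h]
    exact isUnit_one

/-- The reflection `f(x) ↦ f(-x)`. -/
def reflect : TimeSeries →+* TimeSeries := MvPowerSeries.rescale fun _ => (-1 : ℂ)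

lemma D_reflect (i : ℕ+) (f : TimeSeries) : D i (reflect f) = -reflect (D i f) := by
  ext m
  rw [map_neg, reflect, coeff_D, MvPowerSeries.coeff_rescale, MvPowerSeries.coeff_rescale, coeff_D,
    Finsupp.prod_add_index' (h := fun _ n => (-1 : ℂ) ^ n) (fun _ => pow_zero _)
      (fun _ _ _ => pow_add _ _ _),
    Finsupp.prod_single_index (h := fun _ n => (-1 : ℂ) ^ n) (pow_zero _)]
  ring

lemma constantCoeff_reflect (f : TimeSeries) :
    MvPowerSeries.constantCoeff (reflect f) = MvPowerSeries.constantCoeff f := by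
  rw [← MvPowerSeries.coeff_zero_eq_constantCoeff_apply, reflect, MvPowerSeries.coeff_rescale,
    Finsupp.prod_zero_index, one_mul, MvPowerSeries.coeff_zero_eq_constantCoeff_apply]

lemma reflect_smul (c : ℂ) (f : TimeSeries) : reflect (c • f) = c • reflect f := by
  ext m
  rw [reflect, MvPowerSeries.coeff_smul, MvPowerSeries.coeff_rescale, MvPowerSeries.coeff_rescale,
    MvPowerSeries.coeff_smul, mul_left_comm]

lemma reflect_expSeries (a : ℕ+ → ℂ) : reflect (expSeries a) = expSeries (-a) := by
  ext m
  rw [reflect, MvPowerSeries.coeff_rescale, coeff_expSeries, coeff_expSeries, ← Finsupp.prod_mul]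
  congr 1
  funext j n
  rw [Pi.neg_apply, neg_pow (a j), mul_div_assoc]

lemma reflect_expPos (p : ℂ) : reflect (expPos p) = expNeg p := reflect_expSeries _

lemma reflect_expNeg (q : ℂ) : reflect (expNeg q) = expPos q := by
  rw [expNeg, reflect_expSeries, expPos]
  congr 1
  funext j
  rw [Pi.neg_apply, neg_neg]

/-- Reflection inverts the exponentials, hence swaps p and q after transposition; the sign of the
denominators is absorbed into b. -/
lemma reflect_solitonTau (p q a b : ι → ℂ) :
    reflect (solitonTau p q a b) = solitonTau q p (-b) a := by
  rw [solitonTau, solitonTau, RingHom.map_det, ← Matrix.det_transpose]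
  congr 1
  ext1 i j
  rw [Matrix.transpose_apply, RingHom.mapMatrix_apply, Matrix.map_apply, Matrix.add_apply,
    Matrix.add_apply, map_add, solitonMatrix, solitonMatrix, reflect_smul, map_sub, map_mul,
    reflect_expPos, reflect_expNeg, map_one, mul_comm (expNeg _)]
  congr 1
  · rw [Matrix.one_apply, Matrix.one_apply]
    by_cases h : i = j <;> simp [h, eq_comm]
  · congr 1
    rw [Pi.neg_apply, ← neg_sub (p j) (q i), neg_mul, neg_div_neg_eq, mul_comm]

end Solitons

/-! ### First-order deformation of solitons from the trivial solution -/

section Deformation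

/-- The coefficients of the family `g` are differentiable at `0`, with derivatives the coefficients
of `g'`. -/
def HasCoeffDeriv (g : ℂ → TimeSeries) (g' : TimeSeries) : Prop :=
  ∀ m, HasDerivAt (fun ε => MvPowerSeries.coeff m (g ε)) (MvPowerSeries.coeff m g') 0

lemma HasCoeffDeriv.D {g : ℂ → TimeSeries} {g' : TimeSeries} (h : HasCoeffDeriv g g') (i : ℕ+) :
    HasCoeffDeriv (fun ε => KP.D i (g ε)) (KP.D i g') := by
  intro m
  simp only [coeff_D]
  exact (h _).mul_const _

lemma HasCoeffDeriv.jet {g : ℂ → TimeSeries} {g' : TimeSeries} (h : HasCoeffDeriv g g')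
    (c : Column) : HasCoeffDeriv (fun ε => KP.jet (g ε) c) (KP.jet g' c) := by
  have h1 : ∀ t : ℕ, HasCoeffDeriv (fun ε => (KP.D 1)^[t] (g ε)) ((KP.D 1)^[t] g') := by
    intro t
    induction t with
    | zero => exact h
    | succ t ih =>
      simp only [Function.iterate_succ_apply']
      exact ih.D 1
  exact (h1 c.2).D c.1

lemma hasCoeffDeriv_eval (f : Polynomial TimeSeries) :
    HasCoeffDeriv (fun ε => f.eval (MvPowerSeries.C ε)) (f.coeff 1) := by
  intro m
  induction f using Polynomial.induction_on' with
  | add f g hf hg =>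
    simp only [Polynomial.eval_add, Polynomial.coeff_add, map_add]
    exact hf.add hg
  | monomial n a =>
    have h1 : ∀ ε : ℂ, MvPowerSeries.coeff m ((Polynomial.monomial n a).eval (MvPowerSeries.C ε)) =
        ε ^ n * MvPowerSeries.coeff m a := by
      intro ε
      rw [Polynomial.eval_monomial, ← map_pow, mul_comm, MvPowerSeries.coeff_C_mul]
    simp only [h1, Polynomial.coeff_monomial]
    refine ((hasDerivAt_pow n (0 : ℂ)).mul_const (MvPowerSeries.coeff m a)).congr_deriv ?_
    match n with
    | 0 => simp
    | 1 => simp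
    | n + 2 => simp

/-- First order deformation of the logarithm of a family of power series with value `1` at `0`. -/
lemma hasCoeffDeriv_log {τ v : ℂ → TimeSeries} {M : TimeSeries} (hτ : HasCoeffDeriv τ M)
    (h0 : τ 0 = 1) (h1 : ∀ ε, MvPowerSeries.constantCoeff (τ ε) = 1)
    (hv0 : ∀ ε, MvPowerSeries.constantCoeff (v ε) = 0)
    (hv : ∀ ε i, τ ε * D i (v ε) = -D i (τ ε)) (hM : MvPowerSeries.constantCoeff M = 0) :
    HasCoeffDeriv v (-M) := by
  have hz : v 0 = 0 := by
    refine MvPowerSeries.pderiv.ext (fun i => ?_) (by rw [hv0, map_zero])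
    have := hv 0 i
    rw [h0, one_mul, Derivation.map_one_eq_zero, neg_zero] at this
    rw [map_zero]
    exact this
  intro m
  induction hd : m.degree using Nat.strong_induction_on generalizing m with
  | _ d ih =>
    by_cases hm : m = 0
    · subst hm
      simp only [MvPowerSeries.coeff_zero_eq_constantCoeff_apply, hv0, map_neg, hM, neg_zero]
      exact hasDerivAt_const _ _
    · obtain ⟨i, hi⟩ := Finsupp.ne_iff.mp hm
      obtain ⟨m, rfl⟩ : ∃ m', m = m' + Finsupp.single i 1 :=
        ⟨m - Finsupp.single i 1, (tsub_add_cancel_of_le (Finsupp.single_le_iff.mpr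
          (Nat.one_le_iff_ne_zero.mpr hi))).symm⟩
      have hc : (m i : ℂ) + 1 ≠ 0 := by exact_mod_cast Nat.succ_ne_zero (m i)
      -- The equation τ ∂_i v = -∂_i τ is solved for the top coefficient of v, using that τ has
      -- constant term 1.
      have key : ∀ ε, MvPowerSeries.coeff (m + Finsupp.single i 1) (v ε) =
          -MvPowerSeries.coeff (m + Finsupp.single i 1) (τ ε) -
          (∑ p ∈ (antidiagonal m).erase (0, m), MvPowerSeries.coeff p.1 (τ ε) *
            (MvPowerSeries.coeff (p.2 + Finsupp.single i 1) (v ε) * ((p.2 i : ℂ) + 1))) /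
            ((m i : ℂ) + 1) := by
        intro ε
        have h := congrArg (MvPowerSeries.coeff m) (hv ε i)
        rw [MvPowerSeries.coeff_mul, ← Finset.add_sum_erase _ _
          (show ((0 : ℕ+ →₀ ℕ), m) ∈ antidiagonal m by simp), map_neg, coeff_D, coeff_D,
          MvPowerSeries.coeff_zero_eq_constantCoeff_apply, h1, one_mul] at h
        simp only [coeff_D] at h
        rw [eq_sub_iff_add_eq, ← eq_sub_iff_add_eq', div_eq_iff hc]
        linear_combination h
      simp only [key]
      -- Both factors of each term vanish at ε = 0, since τ = 1 and v = 0 there, so the products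
      -- have derivative zero.
      have hsum : HasDerivAt (fun ε => ∑ p ∈ (antidiagonal m).erase (0, m),
          MvPowerSeries.coeff p.1 (τ ε) *
            (MvPowerSeries.coeff (p.2 + Finsupp.single i 1) (v ε) * ((p.2 i : ℂ) + 1)))
          (∑ p ∈ (antidiagonal m).erase (0, m), 0) 0 := by
        refine HasDerivAt.fun_sum fun p hp => ?_
        obtain ⟨hp0, hp⟩ := Finset.mem_erase.mp hp
        have hp := mem_antidiagonal.mp hp
        have hp1 : p.1 ≠ 0 := by
          intro h
          apply hp0
          rw [h, zero_add] at hp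
          exact Prod.ext h hp
        have hdeg : (p.2 + Finsupp.single i 1).degree < d := by
          rw [← hd, ← hp, map_add, map_add, map_add]
          have := Nat.pos_of_ne_zero (mt (Finsupp.degree_eq_zero_iff p.1).mp hp1)
          omega
        have h2 := (hτ p.1).fun_mul ((ih _ hdeg _ rfl).mul_const ((p.2 i : ℂ) + 1))
        refine h2.congr_deriv ?_
        rw [hz, h0, map_zero, MvPowerSeries.coeff_one, if_neg hp1]
        ring
      refine ((hτ (m + Finsupp.single i 1)).neg.sub (hsum.div_const _)).congr_deriv ?_
      rw [Finset.sum_const_zero, zero_div, sub_zero, map_neg]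

variable {ι : Type*} [Fintype ι]

/-- The linear term of det(1 + εA) is ε tr A; the determinant is formed with a polynomial variable
that is specialised to ε. -/
lemma hasCoeffDeriv_solitonTau [DecidableEq ι] (p q a b : ι → ℂ) :
    HasCoeffDeriv (fun ε => solitonTau p q a (ε • b)) (solitonMatrix p q a b).trace := by
  have h := hasCoeffDeriv_eval
    (1 + (Polynomial.X : Polynomial TimeSeries) • (solitonMatrix p q a b).map Polynomial.C).det
  rw [Matrix.coeff_det_one_add_X_smul_one] at h
  convert h using 2 with ε
  rw [← Polynomial.coe_evalRingHom, RingHom.map_det, solitonTau]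
  congr 1
  ext1 i j
  rw [RingHom.mapMatrix_apply, Matrix.map_apply, Matrix.add_apply, Matrix.add_apply, map_add,
    Matrix.smul_apply, Matrix.map_apply, smul_eq_mul, map_mul, Polynomial.coe_evalRingHom,
    Polynomial.eval_X, Polynomial.eval_C, ← MvPowerSeries.smul_eq_C_mul]
  congr 1
  · rw [Matrix.one_apply, Matrix.one_apply]
    split_ifs <;> simp
  · rw [solitonMatrix, solitonMatrix, smul_smul, Pi.smul_apply, smul_eq_mul]
    congr 1
    ring

lemma D_expPos_mul_expNeg (p q : ℂ) (i : ℕ+) :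
    D i (expPos p * expNeg q) = (p ^ (i : ℕ) - q ^ (i : ℕ)) • (expPos p * expNeg q) := by
  have h1 := dNat_expPos p i.ne_zero
  have h2 := dNat_expNeg q i.ne_zero
  rw [dNat_coe] at h1 h2
  rw [Derivation.leibniz, h1, h2, smul_eq_mul, smul_eq_mul, mul_smul_comm, mul_smul_comm,
    mul_comm (expNeg q), ← add_smul]
  congr 1
  ring

lemma constantCoeff_jet_trace (p q a b : ι → ℂ) (c : Column) :
    MvPowerSeries.constantCoeff (jet (solitonMatrix p q a b).trace c) =
      ∑ i, a i * b i / (p i - q i) *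
        ((p i ^ (c.1 : ℕ) - q i ^ (c.1 : ℕ)) * (p i - q i) ^ (c.2 : ℕ)) := by
  have h1 : ∀ t : ℕ, (D 1)^[t + 1] (solitonMatrix p q a b).trace =
      ∑ i, (a i * b i / (p i - q i) * (p i - q i) ^ (t + 1)) • (expPos (p i) * expNeg (q i)) := by
    intro t
    induction t with
    | zero =>
      rw [zero_add, Function.iterate_one, Matrix.trace, map_sum]
      refine Finset.sum_congr rfl fun i _ => ?_
      rw [Matrix.diag_apply, solitonMatrix, Derivation.map_smul, map_sub,
        Derivation.map_one_eq_zero, sub_zero, D_expPos_mul_expNeg, smul_smul, PNat.one_coe, pow_one,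
        pow_one, pow_one]
    | succ t ih =>
      rw [Function.iterate_succ_apply', ih, map_sum]
      refine Finset.sum_congr rfl fun i _ => ?_
      rw [Derivation.map_smul, D_expPos_mul_expNeg, smul_smul, PNat.one_coe, pow_one, pow_one,
        pow_succ _ (t + 1), ← mul_assoc]
  rw [jet, ← c.2.natPred_add_one, h1, map_sum, map_sum]
  refine Finset.sum_congr rfl fun i _ => ?_
  rw [Derivation.map_smul, D_expPos_mul_expNeg, smul_smul, MvPowerSeries.smul_eq_C_mul, map_mul,
    MvPowerSeries.constantCoeff_C, map_mul, expPos, expNeg, constantCoeff_expSeries,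
    constantCoeff_expSeries]
  ring

lemma constantCoeff_trace (p q a b : ι → ℂ) :
    MvPowerSeries.constantCoeff (solitonMatrix p q a b).trace = 0 := by
  have h := constantCoeff_solitonMatrix p q a b
  rw [AddMonoidHom.map_trace, h, Matrix.trace_zero]

lemma solitonTau_zero [DecidableEq ι] (p q a : ι → ℂ) : solitonTau p q a 0 = 1 := by
  have h : solitonMatrix p q a 0 = 0 := by
    ext1 i j
    simp [solitonMatrix]
  rw [solitonTau, h, add_zero, Matrix.det_one]

end Deformation

/-! ### Zariski density of the soliton jets at the origin -/

section Density

/-- If a polynomial vanishes along a differentiable curve through the origin, then its lowest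
homogeneous part vanishes at the tangent vector. -/
lemma sum_lowest_eq_zero {σ : Type*} (P : MvPolynomial σ ℂ) (d : ℕ)
    (hd : ∀ m ∈ P.support, d ≤ m.degree) {J : ℂ → σ → ℂ} {L : σ → ℂ}
    (hJ : ∀ c, HasDerivAt (fun ε => J ε c) (L c) 0) (h0 : ∀ c, J 0 c = 0)
    (hP : ∀ ε, MvPolynomial.eval (J ε) P = 0) :
    ∑ m ∈ P.support, P.coeff m * 0 ^ (m.degree - d) * ∏ c ∈ m.support, L c ^ m c = 0 := by
  -- Divide by ε^d and let ε tend to 0. By 0^0 = 1, the factor 0^(deg m - d) selects the monomials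
  -- of degree d.
  have h1 : Filter.Tendsto (fun ε : ℂ => ∑ m ∈ P.support, P.coeff m * ε ^ (m.degree - d) *
      ∏ c ∈ m.support, (ε⁻¹ * J ε c) ^ m c) (nhdsWithin 0 {0}ᶜ)
      (nhds (∑ m ∈ P.support, P.coeff m * 0 ^ (m.degree - d) *
        ∏ c ∈ m.support, L c ^ m c)) := by
    refine tendsto_finsetSum _ fun m _ => ?_
    refine Filter.Tendsto.mul (tendsto_const_nhds.mul ?_) (tendsto_finsetProd _ fun c _ => ?_)
    · exact (Filter.tendsto_id.pow _).mono_left nhdsWithin_le_nhds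
    · have := hasDerivAt_iff_tendsto_slope_zero.mp (hJ c)
      simp only [zero_add, h0, sub_zero, smul_eq_mul] at this
      exact this.pow _
  refine tendsto_nhds_unique h1 (tendsto_const_nhds.congr' ?_)
  filter_upwards [self_mem_nhdsWithin] with ε hε
  have hε : ε ≠ 0 := hε
  have h2 := hP ε
  rw [MvPolynomial.eval_eq] at h2
  refine (mul_left_cancel₀ (pow_ne_zero d hε) ?_).symm
  rw [mul_zero, ← h2, Finset.mul_sum]
  refine Finset.sum_congr rfl fun m hm => ?_
  simp only [mul_pow]
  rw [Finset.prod_mul_distrib, Finset.prod_pow_eq_pow_sum, ← Finsupp.degree_apply, inv_pow]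
  have h3 : ε ^ m.degree = ε ^ d * ε ^ (m.degree - d) := by
    rw [← pow_add, Nat.add_sub_cancel' (hd m hm)]
  have h4 := mul_inv_cancel₀ (pow_ne_zero m.degree hε)
  calc ε ^ d * (P.coeff m * ε ^ (m.degree - d) * ((ε ^ m.degree)⁻¹ *
        ∏ c ∈ m.support, J ε c ^ m c))
      = (ε ^ d * ε ^ (m.degree - d)) * (ε ^ m.degree)⁻¹ *
        (P.coeff m * ∏ c ∈ m.support, J ε c ^ m c) := by ring
    _ = _ := by rw [← h3, h4, one_mul]

/-- The eigenvalue of `∂_s ∂₁^t` on the exponential `exp (∑ x_j (x^j - y^j))`. -/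
def columnSymbol (x y : ℂ) (c : Column) : ℂ :=
  (x ^ (c.1 : ℕ) - y ^ (c.1 : ℕ)) * (x - y) ^ (c.2 : ℕ)

/-- Induct on t: once all smaller t are excluded, divide by (x - y)^(t+1) and set y = x. What
remains is ∑ r_i s_i x^(s_i - 1) over columns with that t, whose s_i are distinct. The sample points
k and -(l + 1) never coincide and suffice to identify polynomials. -/
lemma columnSymbol_independent {ι : Type*} [Fintype ι] (c : ι → Column)
    (hc : Function.Injective c) (r : ι → ℂ)
    (h : ∀ k l : ℕ, ∑ i, r i * columnSymbol k (-(l + 1)) (c i) = 0) (i : ι) : r i = 0 := by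
  classical
  induction ht : ((c i).2 : ℕ) using Nat.strong_induction_on generalizing i with
  | _ t ih =>
    have h1 : ∀ k : ℕ, ∑ i, (if t ≤ ((c i).2 : ℕ) then
        Polynomial.C (r i) * ((Polynomial.C (k : ℂ) - Polynomial.X) ^ (((c i).2 : ℕ) - t) *
          ∑ j ∈ Finset.range (c i).1, Polynomial.C (k : ℂ) ^ j *
            Polynomial.X ^ (((c i).1 : ℕ) - 1 - j)) else 0) = 0 := by
      intro k
      refine Polynomial.eq_zero_of_infinite_isRoot _
        (Set.infinite_of_injective_forall_mem (f := fun l : ℕ => -((l : ℂ) + 1)) ?_ ?_)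
      · intro l l' hl
        simpa using hl
      · intro l
        have hne : (k : ℂ) - -((l : ℂ) + 1) ≠ 0 := by
          rw [sub_neg_eq_add]
          exact_mod_cast Nat.succ_ne_zero (k + l)
        rw [Set.mem_ofPred_eq, Polynomial.IsRoot, Polynomial.eval_finsetSum]
        refine mul_left_cancel₀ (pow_ne_zero (t + 1) hne) ?_
        rw [mul_zero, ← h k l, Finset.mul_sum]
        refine Finset.sum_congr rfl fun i _ => ?_
        split_ifs with hti
        · simp only [Polynomial.eval_mul, Polynomial.eval_pow, Polynomial.eval_sub,
            Polynomial.eval_C, Polynomial.eval_X, Polynomial.eval_finsetSum]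
          rw [columnSymbol, ← geom_sum₂_mul]
          obtain ⟨u, hu⟩ := Nat.exists_eq_add_of_le hti
          rw [hu, Nat.add_sub_cancel_left]
          ring
        · rw [ih _ (not_le.mp hti) i rfl, Polynomial.eval_zero, mul_zero, zero_mul]
    have h2 : ∑ i, (if ((c i).2 : ℕ) = t then
        Polynomial.monomial (((c i).1 : ℕ) - 1) (r i * ((c i).1 : ℕ)) else 0) = 0 := by
      refine Polynomial.eq_zero_of_infinite_isRoot _
        (Set.infinite_of_injective_forall_mem (f := fun k : ℕ => (k : ℂ)) Nat.cast_injective ?_)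
      intro k
      rw [Set.mem_ofPred_eq, Polynomial.IsRoot, Polynomial.eval_finsetSum]
      have h3 := congrArg (Polynomial.eval (k : ℂ)) (h1 k)
      rw [Polynomial.eval_finsetSum, Polynomial.eval_zero] at h3
      rw [← h3]
      refine Finset.sum_congr rfl fun i _ => ?_
      rcases lt_trichotomy ((c i).2 : ℕ) t with hlt | heq | hgt
      · rw [if_neg hlt.ne, if_neg (not_le.mpr hlt)]
      · rw [if_pos heq, if_pos heq.ge, heq, Nat.sub_self, pow_zero, one_mul,
          Polynomial.eval_monomial]
        simp only [Polynomial.eval_mul, Polynomial.eval_pow,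
            Polynomial.eval_C, Polynomial.eval_X, Polynomial.eval_finsetSum]
        rw [geom_sum₂_self]
        ring
      · rw [if_neg hgt.ne', if_pos hgt.le, Polynomial.eval_zero]
        simp only [Polynomial.eval_mul, Polynomial.eval_pow, Polynomial.eval_sub,
            Polynomial.eval_C, Polynomial.eval_X]
        rw [sub_self, zero_pow (Nat.sub_ne_zero_of_lt hgt), zero_mul, mul_zero]
    have h3 := congrArg (Polynomial.coeff · (((c i).1 : ℕ) - 1)) h2
    simp only [Polynomial.finsetSum_coeff, Polynomial.coeff_zero] at h3
    rw [Finset.sum_eq_single i, if_pos ht, Polynomial.coeff_monomial, if_pos rfl] at h3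
    · exact (mul_eq_zero.mp h3).resolve_right (Nat.cast_ne_zero.mpr (c i).1.ne_zero)
    · intro j _ hj
      split_ifs with hjt
      · rw [Polynomial.coeff_monomial, if_neg]
        intro hs
        refine hj (hc (Prod.ext ?_ ?_))
        · have h4 := (c i).1.pos
          have h5 := (c j).1.pos
          exact PNat.coe_inj.mp (by omega)
        · exact PNat.coe_inj.mp (hjt.trans ht.symm)
      · rw [Polynomial.coeff_zero]
    · intro hi
      exact absurd (Finset.mem_univ i) hi

/-- Every prescribed linear part is attained by a combination of exponentials. -/
lemma exists_combination (V : Finset Column) (L : Column → ℂ) :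
    ∃ (n : ℕ) (f : Fin n → ℂ) (k l : Fin n → ℕ), ∀ c ∈ V,
      ∑ i, f i * columnSymbol (k i) (-(l i + 1)) c = L c := by
  classical
  set w : ℕ × ℕ → V → ℂ := fun x c => columnSymbol x.1 (-(x.2 + 1)) c with hw
  have htop : Submodule.span ℂ (Set.range w) = ⊤ := by
    -- A proper span would be annihilated by a nonzero functional, that is, by a nontrivial linear
    -- relation among the symbols.
    by_contra hne
    obtain ⟨f, hf, hle⟩ := Submodule.exists_le_ker_of_lt_top _ (lt_top_iff_ne_top.mpr hne)
    have h1 := columnSymbol_independent (fun c : V => (c : Column)) Subtype.val_injective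
      (fun c => f (Pi.single c 1)) (fun k l => by
        have h2 : f (w (k, l)) = 0 := hle (Submodule.subset_span ⟨_, rfl⟩)
        rw [LinearMap.pi_apply_eq_sum_univ] at h2
        rw [← h2]
        refine Finset.sum_congr rfl fun c _ => ?_
        rw [smul_eq_mul, mul_comm]
        congr 2
        ext c'
        simp [Pi.single_apply, eq_comm])
    apply hf
    ext c
    simpa using h1 c
  have hmem : (fun c : V => L c) ∈ Submodule.span ℂ (Set.range w) := htop ▸ Submodule.mem_top
  obtain ⟨n, f, g, hg⟩ := Submodule.mem_span_set'.mp hmem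
  choose x hx using fun i => (g i).2
  refine ⟨n, f, fun i => (x i).1, fun i => (x i).2, fun c hc => ?_⟩
  have := congrFun hg ⟨c, hc⟩
  rw [← this, Finset.sum_apply]
  refine Finset.sum_congr rfl fun i _ => ?_
  rw [Pi.smul_apply, smul_eq_mul, ← hx i]

/-- The jets at the origin of the soliton solutions are Zariski dense. -/
theorem eq_zero_of_eval_jet (P : MvPolynomial Column ℂ)
    (h : ∀ (n : ℕ) (p q a b : Fin n → ℂ) (v : TimeSeries), (∀ i j, p i ≠ q j) →
      (∀ i, solitonTau p q a b * D i v = -D i (solitonTau p q a b)) →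
      MvPolynomial.eval (fun c => MvPowerSeries.constantCoeff (jet v c)) P = 0) : P = 0 := by
  classical
  by_contra hP
  obtain ⟨m₀, hm₀, hmin⟩ := Finset.exists_min_image P.support Finsupp.degree
    (Finset.nonempty_of_ne_empty (mt MvPolynomial.support_eq_empty.mp hP))
  set d := m₀.degree with hd
  set Q : MvPolynomial Column ℂ :=
    ∑ m ∈ P.support, MvPolynomial.monomial m (P.coeff m * 0 ^ (m.degree - d)) with hQ
  have hQ0 : Q = 0 := by
    refine MvPolynomial.funext fun L => ?_
    obtain ⟨n, f, k, l, hL⟩ := exists_combination P.vars L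
    have hpq : ∀ i j, (k i : ℂ) ≠ -((l j : ℂ) + 1) := by
      intro i j hij
      rw [eq_neg_iff_add_eq_zero] at hij
      exact Nat.succ_ne_zero (k i + l j) (by exact_mod_cast hij)
    set p : Fin n → ℂ := fun i => k i with hp
    set q : Fin n → ℂ := fun i => -(l i + 1) with hq
    -- This cancels the denominators on the diagonal of the soliton matrix and the sign in v = -log
    -- τ, so that the tangent jets are exactly those prescribed by L.
    set a : Fin n → ℂ := fun i => -(f i * (p i - q i)) with ha
    choose v hv0 hv using fun ε : ℂ => exists_log (solitonTau p q a (ε • 1))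
      (by rw [constantCoeff_solitonTau]; exact one_ne_zero)
    have hder : HasCoeffDeriv v (-(solitonMatrix p q a 1).trace) :=
      hasCoeffDeriv_log (hasCoeffDeriv_solitonTau p q a 1)
        (by rw [zero_smul, solitonTau_zero]) (fun ε => constantCoeff_solitonTau _ _ _ _) hv0 hv
        (constantCoeff_trace _ _ _ _)
    have hjet0 : ∀ c, MvPowerSeries.constantCoeff (jet (v 0) c) = 0 := by
      have hz : v 0 = 0 := by
        refine MvPowerSeries.pderiv.ext (fun i => ?_) (by rw [hv0, map_zero])
        have := hv 0 i
        rw [zero_smul, solitonTau_zero, one_mul, Derivation.map_one_eq_zero, neg_zero] at this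
        rw [map_zero]
        exact this
      intro c
      rw [hz, jet, iterate_map_zero, map_zero, map_zero]
    have hlow := sum_lowest_eq_zero P d hmin (J := fun ε c =>
      MvPowerSeries.constantCoeff (jet (v ε) c))
      (L := fun c => MvPowerSeries.constantCoeff (jet (-(solitonMatrix p q a 1).trace) c))
      (fun c => (hder.jet c) 0) hjet0 (fun ε => h n p q a (ε • 1) (v ε) hpq (hv ε))
    rw [map_zero, hQ, map_sum]
    refine Eq.trans ?_ hlow
    refine Finset.sum_congr rfl fun m hm => ?_
    rw [MvPolynomial.eval_monomial, Finsupp.prod]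
    refine congrArg (P.coeff m * 0 ^ (m.degree - d) * ·)
      (Finset.prod_congr rfl fun c hcm => congrArg (· ^ m c) ?_)
    rw [← hL c ((MvPolynomial.mem_vars_iff_mem_support c).mpr ⟨m, hm, hcm⟩)]
    have hneg : jet (-(solitonMatrix p q a 1).trace) c = -jet (solitonMatrix p q a 1).trace c := by
      rw [jet, jet, iterate_map_neg, map_neg]
    rw [hneg, map_neg, constantCoeff_jet_trace, ← Finset.sum_neg_distrib]
    refine Finset.sum_congr rfl fun i _ => ?_
    rw [columnSymbol]
    have hne : p i - q i ≠ 0 := sub_ne_zero.mpr (hpq i i)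
    change f i * ((p i ^ _ - q i ^ _) * (p i - q i) ^ _) = _
    rw [Pi.one_apply, mul_one, ha, neg_div, mul_div_cancel_right₀ _ hne]
    ring
  have h1 := congrArg (MvPolynomial.coeff m₀) hQ0
  rw [hQ, MvPolynomial.coeff_sum, MvPolynomial.coeff_zero, Finset.sum_eq_single m₀,
    MvPolynomial.coeff_monomial, if_pos rfl, ← hd, Nat.sub_self, pow_zero, mul_one] at h1
  · exact MvPolynomial.mem_support_iff.mp hm₀ h1
  · intro m _ hne
    rw [MvPolynomial.coeff_monomial, if_neg hne]
  · intro hn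
    exact absurd hm₀ hn

end Density

/-! ### Uniqueness and parity of the coefficients -/

section Uniqueness

/-- A rational polynomial vanishing on the jets at the origin of all soliton solutions is zero. -/
lemma eq_zero_of_constantCoeff_aeval (P : MvPolynomial Column ℚ)
    (h : ∀ (n : ℕ) (p q a b : Fin n → ℂ) (v : TimeSeries), (∀ i j, p i ≠ q j) →
      (∀ i, solitonTau p q a b * D i v = -D i (solitonTau p q a b)) →
      MvPowerSeries.constantCoeff (MvPolynomial.aeval (jet v) P) = 0) : P = 0 := by
  refine MvPolynomial.map_injective (algebraMap ℚ ℂ) (algebraMap ℚ ℂ).injective ?_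
  rw [map_zero]
  refine eq_zero_of_eval_jet _ fun n p q a b v hpq hv => ?_
  rw [MvPolynomial.eval_map, ← h n p q a b v hpq hv, MvPolynomial.map_aeval,
    MvPolynomial.eval₂Hom]
  congr 1

theorem IsUniversal.unique {R R' : ℕ+ → ℕ+ → MvPolynomial Column ℚ} (h : IsUniversal R)
    (h' : IsUniversal R') : R' = R := by
  funext i j
  refine sub_eq_zero.mp (eq_zero_of_constantCoeff_aeval _ fun n p q a b v hpq hv => ?_)
  have hsol := isSolution_soliton p q a b hpq hv
  rw [map_sub, ← (h i j).2 v hsol, ← (h' i j).2 v hsol, sub_self, map_zero]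

/-- The sign of a column under the reflection `x ↦ -x` of the times, up to the sign of the index
`s`. -/
def columnSign (c : Column) : ℚ := (-1) ^ ((c.2 : ℕ) + 1)

lemma jet_reflect (v : TimeSeries) (c : Column) :
    jet (reflect v) c = columnSign c • reflect (jet v c) := by
  have h : ∀ t : ℕ, (D 1)^[t] (reflect v) = ((-1 : ℚ) ^ t) • reflect ((D 1)^[t] v) := by
    intro t
    induction t with
    | zero => simp
    | succ t ih =>
      rw [Function.iterate_succ_apply', Function.iterate_succ_apply', ih, map_rat_smul, D_reflect,
        pow_succ, mul_neg_one, neg_smul, smul_neg]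
  rw [jet, jet, h, map_rat_smul, D_reflect, columnSign, pow_succ, mul_neg_one, neg_smul, smul_neg]

lemma coeff_aeval_columnSign (P : MvPolynomial Column ℚ) (m : Column →₀ ℕ) :
    (MvPolynomial.aeval (fun c => MvPolynomial.C (columnSign c) * MvPolynomial.X c) P :
      MvPolynomial Column ℚ).coeff m = (m.prod fun c n => columnSign c ^ n) * P.coeff m := by
  induction P using MvPolynomial.induction_on' with
  | monomial u r =>
    have h : (MvPolynomial.aeval (fun c => MvPolynomial.C (columnSign c) * MvPolynomial.X c)
        (MvPolynomial.monomial u r) : MvPolynomial Column ℚ) =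
        MvPolynomial.monomial u (r * u.prod fun c n => columnSign c ^ n) := by
      rw [MvPolynomial.aeval_monomial, MvPolynomial.monomial_eq, map_mul]
      simp only [mul_pow, Finsupp.prod, Finset.prod_mul_distrib, map_prod, map_pow, mul_assoc]
      rfl
    rw [h, MvPolynomial.coeff_monomial, MvPolynomial.coeff_monomial]
    split_ifs with hum
    · rw [hum, mul_comm]
    · rw [mul_zero]
  | add P Q hP hQ => rw [map_add, MvPolynomial.coeff_add, MvPolynomial.coeff_add, hP, hQ, mul_add]

/-- Compare the universal identity for a soliton with the one for its reflection at the origin. The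
two signs from ∂_i ∂_j cancel, and density turns equality of values into equality of polynomials. -/
theorem IsUniversal.aeval_columnSign {R : ℕ+ → ℕ+ → MvPolynomial Column ℚ} (h : IsUniversal R)
    (i j : ℕ+) :
    MvPolynomial.aeval (fun c => MvPolynomial.C (columnSign c) * MvPolynomial.X c) (R i j) =
      R i j := by
  refine sub_eq_zero.mp (eq_zero_of_constantCoeff_aeval _ fun n p q a b v hpq hv => ?_)
  have hsol := isSolution_soliton p q a b hpq hv
  have hsol' : IsSolution (reflect v) := by
    refine isSolution_soliton q p (-b) a (fun i j => (hpq j i).symm) fun i => ?_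
    rw [← reflect_solitonTau, D_reflect, D_reflect, mul_neg, ← map_mul, hv, map_neg]
  have h1 := congrArg (MvPowerSeries.constantCoeff (R := ℂ)) ((h i j).2 _ hsol')
  rw [D_reflect, map_neg, D_reflect, neg_neg, constantCoeff_reflect, (h i j).2 v hsol] at h1
  rw [map_sub, map_sub, h1, sub_eq_zero]
  have h2 : ∀ (w : Column → TimeSeries) (P : MvPolynomial Column ℚ),
      MvPowerSeries.constantCoeff (MvPolynomial.aeval w P) =
        MvPolynomial.aeval (fun c => MvPowerSeries.constantCoeff (w c)) P := by
    intro w P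
    rw [MvPolynomial.map_aeval, MvPolynomial.aeval_def, MvPolynomial.coe_eval₂Hom]
    congr 1
  rw [← AlgHom.comp_apply, MvPolynomial.comp_aeval, h2, h2]
  congr 2
  funext c
  rw [map_mul, MvPolynomial.aeval_X, MvPolynomial.algHom_C, jet_reflect, map_mul,
    Algebra.smul_def, map_mul, constantCoeff_reflect]

lemma IsUniversal.coeff_columns_eq_zero {R : ℕ+ → ℕ+ → MvPolynomial Column ℚ}
    (h : IsUniversal R) (i j : ℕ+) {m : ℕ} (s t : Fin m → ℕ+)
    (hst : (∑ a, ((t a : ℕ) + 1)) ≡ 1 [MOD 2]) : (R i j).coeff (columns s t) = 0 := by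
  have h1 := coeff_aeval_columnSign (R i j) (columns s t)
  have h2 : ((columns s t).prod fun c n => columnSign c ^ n) = -1 := by
    rw [columns, ← Finsupp.prod_finsetSum_index (fun _ => pow_zero _) (fun _ _ _ => pow_add _ _ _)]
    simp only [Finsupp.prod_single_index, pow_zero, pow_one, columnSign]
    rw [Finset.prod_pow_eq_pow_sum]
    -- The total sign is (-1) to the sum of the t_a + 1, which is odd, so the coefficient equals its
    -- own negative.
    exact (Nat.odd_iff.mpr hst).neg_one_pow
  rw [h.aeval_columnSign, h2] at h1
  linarith

end Uniqueness

end KP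

end

theorem theorem4p2 :
    ∃ R : ℕ+ → ℕ+ → MvPolynomial KP.Column ℚ,
      KP.IsUniversal R ∧
      (∀ R' : ℕ+ → ℕ+ → MvPolynomial KP.Column ℚ, KP.IsUniversal R' → R' = R) ∧
      ∀ (i j : ℕ+) (m : ℕ) (s t : Fin m → ℕ+),
        (∑ a, ((t a : ℕ) + 1)) ≡ 1 [MOD 2] →
          (R i j).coeff (KP.columns s t) = 0 := by
  obtain ⟨R, hR⟩ := KP.exists_isUniversal
  exact ⟨R, hR, fun R' hR' => hR.unique hR', fun i j _ s t => hR.coeff_columns_eq_zero i j s t⟩
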